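/- Let $(V,g)$ be a real vector space of dimension $2n$ with a positive definite metric. Let $\mathcal T(V,g)=\{J\in \mathrm{End}\,V : J^2=-1,\ g(J\cdot,J\cdot)=g(\cdot,\cdot)\}$, and for $J\in\mathcal T(V,g)$ let $U(J)=\{B\in O(V,g) : BJ=JB\}$, acting on $\mathcal T(V,g)$ by conjugation, $B\cdot K=BKB^{-1}$. For $J,K\in\mathcal T(V,g)$ and $\epsilon\in\mathbb R$ put $V_\epsilon=\mathrm{Ker}(JK+KJ-2\epsilon\mathbb 1)$. Suppose that $$V=V_{e_1}\oplus\dots\oplus V_{e_l}\oplus V_1\oplus V_{-1},\qquad e_i\in(-1,1),$$ where $\dim V_{e_i}=4k_i$, $\dim V_1=2m_1$ and $\dim V_{-1}=2m_{-1}$. Then $n=2k_1+\dots+2k_l+m_1+m_{-1}$, the orbit $U(J)\cdot K$ is an embedded submanifold of $\mathrm{End}\,V$, and $$U(J)\cdot K\;\cong\; U(n)/\bigl(Sp(k_1)\times\dots\times Sp(k_l)\times U(m_1)\times U(m_{-1})\bigr)$$ as smooth homogeneous spaces. Here $Sp(k)=U(2k)\cap Sp(2k,\mathbb C)$, the product is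 embedded in $U(n)$ as the group of block diagonal matrices with these blocks, and the quotient carries the smooth structure for which the projection from $U(n)$ is a smooth submersion; the isomorphism means that there are an isomorphism of Lie groups $\theta:U(n)\to U(J)$ and a diffeomorphism $\Phi$ from the quotient onto the orbit with $\Phi([h])=\theta(h)K\theta(h)^{-1}$ for all $h\in U(n)$. -/

import Mathlib

open scoped Manifold ContDiff InnerProductSpace Matrix.Norms.Elementwise

namespace Twistor

section TwistorSpace

variable {V : Type*} [NormedAddCommGroup V] [InnerProductSpace ℝ V]

/-- The twistor space of `(V, g)`: the orthogonal complex structures on `V`. The space `V` will be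
finite dimensional, so that `V →L[ℝ] V` is all of `End V`, with its usual topology. -/
def twistorSpace (V : Type*) [NormedAddCommGroup V] [InnerProductSpace ℝ V] :
    Set (V →L[ℝ] V) :=
  {J | J * J = -1 ∧ ∀ x y : V, ⟪J x, J y⟫_ℝ = ⟪x, y⟫_ℝ}

/-- `U(J)`: the orthogonal transformations of `V` that commute with `J`, as a subgroup of the
(topological) group of invertible endomorphisms of `V`. -/
def unitaryOf (J : V →L[ℝ] V) : Subgroup (V →L[ℝ] V)ˣ where
  carrier := {B | (∀ x y : V, ⟪(B : V →L[ℝ] V) x, (B : V →L[ℝ] V) y⟫_ℝ = ⟪x, y⟫_ℝ) ∧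
    (B : V →L[ℝ] V) * J = J * (B : V →L[ℝ] V)}
  one_mem' := ⟨fun _ _ => rfl, by simp⟩
  mul_mem' {A B} hA hB := by
    refine ⟨fun x y => ?_, ?_⟩
    · simp only [Units.val_mul, mul_apply_eq_comp]
      rw [hA.1, hB.1]
    · rw [Units.val_mul, mul_assoc, hB.2, ← mul_assoc, hA.2, mul_assoc]
  inv_mem' {B} hB := by
    have hc : ∀ x : V, (B : V →L[ℝ] V) (((B⁻¹ : (V →L[ℝ] V)ˣ) : V →L[ℝ] V) x) = x :=
        fun x => by
      rw [← mul_apply_eq_comp, Units.mul_inv, one_apply_eq_self]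
    refine ⟨fun x y => ?_, ?_⟩
    · rw [← hB.1, hc, hc]
    · rw [Units.inv_mul_eq_iff_eq_mul, ← mul_assoc, hB.2, mul_assoc, Units.mul_inv, mul_one]

/-- The orbit `U(J) · K` of `K` under conjugation, as a subset of `End V`. -/
def orbit (J K : V →L[ℝ] V) : Set (V →L[ℝ] V) :=
  Set.range fun B : unitaryOf J =>
    ((B : (V →L[ℝ] V)ˣ) : V →L[ℝ] V) * K * ((B : (V →L[ℝ] V)ˣ)⁻¹ : (V →L[ℝ] V)ˣ)

/-- `V_ε = Ker ({J, K} - 2 ε 1)`, where `{J, K} = J K + K J`. -/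
def eigenspace (J K : V →L[ℝ] V) (ε : ℝ) : Submodule ℝ V :=
  LinearMap.ker ((J * K + K * J - (2 * ε) • (1 : V →L[ℝ] V) : V →L[ℝ] V) : V →ₗ[ℝ] V)

/-- The family of subspaces `V_{e_1}, …, V_{e_l}, V_1, V_{-1}`. -/
def eigenspaces (J K : V →L[ℝ] V) {l : ℕ} (e : Fin l → ℝ) : Fin l ⊕ Fin 2 → Submodule ℝ V :=
  Sum.elim (fun i => eigenspace J K (e i)) ![eigenspace J K 1, eigenspace J K (-1)]

end TwistorSpace

section Groups

/-- The compact symplectic group `Sp(k) = U(2k) ∩ Sp(2k, ℂ)`, as a subgroup of `U(2k)`. -/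
def compactSp (k : ℕ) : Subgroup (Matrix.unitaryGroup (Fin k ⊕ Fin k) ℂ) where
  carrier := {A | (A : Matrix (Fin k ⊕ Fin k) (Fin k ⊕ Fin k) ℂ) ∈
    Matrix.symplecticGroup (Fin k) ℂ}
  one_mem' := one_mem (Matrix.symplecticGroup (Fin k) ℂ)
  mul_mem' hA hB := (Matrix.symplecticGroup (Fin k) ℂ).mul_mem hA hB
  inv_mem' {A} hA := by
    have h := (⟨A.1, hA⟩ : Matrix.symplecticGroup (Fin k) ℂ)⁻¹.2
    have h1 : (((⟨A.1, hA⟩ : Matrix.symplecticGroup (Fin k) ℂ)⁻¹ :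
        Matrix.symplecticGroup (Fin k) ℂ) : Matrix (Fin k ⊕ Fin k) (Fin k ⊕ Fin k) ℂ) * A.1 = 1 :=
      congrArg Subtype.val (inv_mul_cancel (⟨A.1, hA⟩ : Matrix.symplecticGroup (Fin k) ℂ))
    have h2 : A.1 * (A⁻¹).1 = 1 := congrArg Subtype.val (mul_inv_cancel A)
    rw [left_inv_eq_right_inv h1 h2] at h
    exact h

/-- Indices of rows and columns of a matrix with `l` diagonal blocks of sizes `2 k_1, …, 2 k_l`
followed by diagonal blocks of sizes `m₁` and `m₂`. -/
abbrev BlockIndex {l : ℕ} (k : Fin l → ℕ) (m₁ m₂ : ℕ) : Type :=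
  (Σ i : Fin l, Fin (k i) ⊕ Fin (k i)) ⊕ (Fin m₁ ⊕ Fin m₂)

variable {l n : ℕ} {k : Fin l → ℕ} {m₁ m₂ : ℕ}

/-- The block diagonal matrix `diag(A_1, …, A_l, B, C)`. -/
def blockMatrix (A : ∀ i, Matrix (Fin (k i) ⊕ Fin (k i)) (Fin (k i) ⊕ Fin (k i)) ℂ)
    (B : Matrix (Fin m₁) (Fin m₁) ℂ) (C : Matrix (Fin m₂) (Fin m₂) ℂ) :
    Matrix (BlockIndex k m₁ m₂) (BlockIndex k m₁ m₂) ℂ :=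
  Matrix.fromBlocks (Matrix.blockDiagonal' A) 0 0 (Matrix.fromBlocks B 0 0 C)

theorem blockMatrix_one : blockMatrix (k := k) (m₁ := m₁) (m₂ := m₂) (fun _ => 1) 1 1 = 1 := by
  have : (fun i => (1 : Matrix (Fin (k i) ⊕ Fin (k i)) (Fin (k i) ⊕ Fin (k i)) ℂ)) = 1 := rfl
  rw [blockMatrix, this, Matrix.blockDiagonal'_one, Matrix.fromBlocks_one, Matrix.fromBlocks_one]

theorem blockMatrix_mul
    (A A' : ∀ i, Matrix (Fin (k i) ⊕ Fin (k i)) (Fin (k i) ⊕ Fin (k i)) ℂ)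
    (B B' : Matrix (Fin m₁) (Fin m₁) ℂ) (C C' : Matrix (Fin m₂) (Fin m₂) ℂ) :
    blockMatrix (fun i => A i * A' i) (B * B') (C * C') =
      blockMatrix A B C * blockMatrix A' B' C' := by
  simp [blockMatrix, Matrix.fromBlocks_multiply, Matrix.blockDiagonal'_mul]

theorem blockMatrix_star
    (A : ∀ i, Matrix (Fin (k i) ⊕ Fin (k i)) (Fin (k i) ⊕ Fin (k i)) ℂ)
    (B : Matrix (Fin m₁) (Fin m₁) ℂ) (C : Matrix (Fin m₂) (Fin m₂) ℂ) :
    star (blockMatrix A B C) = blockMatrix (fun i => star (A i)) (star B) (star C) := by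
  simp [blockMatrix, Matrix.star_eq_conjTranspose, Matrix.fromBlocks_conjTranspose,
    Matrix.blockDiagonal'_conjTranspose]

/-- The block diagonal embedding
`Sp(k_1) × … × Sp(k_l) × U(m₁) × U(m₂) → U(n)`, `(A, B, C) ↦ diag(A_1, …, A_l, B, C)`,
where `ε` is an ordering of the `n = 2 k_1 + … + 2 k_l + m₁ + m₂` indices. -/
def blockHom (ε : BlockIndex k m₁ m₂ ≃ Fin n) :
    (∀ i, compactSp (k i)) × Matrix.unitaryGroup (Fin m₁) ℂ × Matrix.unitaryGroup (Fin m₂) ℂ →*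
      Matrix.unitaryGroup (Fin n) ℂ where
  toFun g := ⟨Matrix.reindex ε ε (blockMatrix (fun i => (g.1 i).1.1) g.2.1.1 g.2.2.1), by
    rw [Matrix.mem_unitaryGroup_iff, Matrix.star_eq_conjTranspose, Matrix.conjTranspose_reindex,
      ← Matrix.star_eq_conjTranspose, blockMatrix_star, Matrix.reindex_apply, Matrix.reindex_apply,
      Matrix.submatrix_mul_equiv, ← blockMatrix_mul,
      Matrix.mem_unitaryGroup_iff.1 g.2.1.2, Matrix.mem_unitaryGroup_iff.1 g.2.2.2,
      funext fun i => Matrix.mem_unitaryGroup_iff.1 (g.1 i).1.2, blockMatrix_one,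
      Matrix.submatrix_one_equiv]⟩
  map_one' := Subtype.ext (by
    change Matrix.reindex ε ε (blockMatrix (fun _ => 1) 1 1) = 1
    rw [blockMatrix_one, Matrix.reindex_apply, Matrix.submatrix_one_equiv])
  map_mul' g h := Subtype.ext (by
    change Matrix.reindex ε ε (blockMatrix (fun i => (g.1 i).1.1 * (h.1 i).1.1)
      (g.2.1.1 * h.2.1.1) (g.2.2.1 * h.2.2.1)) = Matrix.reindex ε ε _ * Matrix.reindex ε ε _
    rw [blockMatrix_mul, Matrix.reindex_apply, Matrix.reindex_apply, Matrix.reindex_apply,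
      Matrix.submatrix_mul_equiv])

/-- The subgroup `Sp(k_1) × … × Sp(k_l) × U(m₁) × U(m₂)` of `U(n)`, block diagonally embedded. -/
def blockSubgroup (ε : BlockIndex k m₁ m₂ ≃ Fin n) : Subgroup (Matrix.unitaryGroup (Fin n) ℂ) :=
  (blockHom ε).range

end Groups

section Manifolds

/-- A smooth structure of dimension `d` on a subspace `X` of a normed space `E`, with inclusion map
`incl`, makes `X` an embedded submanifold of `E`. For a given `X`, such a structure is
unique up to equivalence of atlases. -/
def IsEmbeddedSubmanifold {X E : Type*} [TopologicalSpace X] [NormedAddCommGroup E]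
    [NormedSpace ℝ E] (d : ℕ) [ChartedSpace (EuclideanSpace ℝ (Fin d)) X] (incl : X → E) : Prop :=
  IsManifold (𝓡 d) ∞ X ∧ Manifold.IsSmoothEmbedding (𝓡 d) 𝓘(ℝ, E) ∞ incl

/-- A smooth structure of dimension `d` on `G ⧸ H`, with the quotient topology, is the quotient
smooth structure: the projection `G → G ⧸ H` is a smooth submersion. For a given smooth structure
on `G`, such a structure is unique up to equivalence of atlases. -/
def IsQuotientManifold {G : Type*} [Group G] [TopologicalSpace G] (c : ℕ)
    [ChartedSpace (EuclideanSpace ℝ (Fin c)) G] (H : Subgroup G) (d : ℕ)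
    [ChartedSpace (EuclideanSpace ℝ (Fin d)) (G ⧸ H)] : Prop :=
  IsManifold (𝓡 d) ∞ (G ⧸ H) ∧
    Manifold.IsSubmersion (𝓡 c) (𝓡 d) ∞ (QuotientGroup.mk : G → G ⧸ H)

end Manifolds

end Twistor

/-! The algebra. On `V_ε` write `K = -εJ + R`. The relation `JK + KJ = 2ε` says that `R`
anticommutes with `J` and that `R² = -(1 - ε²)`. For `|ε| < 1` the operators `J` and `R/√(1 - ε²)`
therefore make `V_ε` quaternionic, while `R = 0` for `ε = ±1`. Since `JK + KJ` is self-adjoint, its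
eigenspaces are orthogonal, and they are stable under `J` and `K`; so `V` has a `J`-unitary frame
adapted to all of this (`exists_adaptedFrame`). In its coordinates `V = ℂⁿ`, `J = i`, `U(J) = U(n)`,
and `K z = -i D z + S z̄`, with `D` the real diagonal matrix of the eigenvalues and `S` block
diagonal, with multiples of the standard symplectic matrix and two zero blocks. Comparing linear and
antilinear parts, a unitary `A` fixes `K` iff `AD = DA` and `AS = SĀ` (`commute_matrixHom_iff`). The
first equation forces the block form; the second makes each of the first `l` blocks symplectic and
does not constrain the last two. Hence the stabilizer of `K` is the block subgroup
(`mem_blockSubgroup_iff`).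

The smooth structures. Split the skew-adjoint matrices into those commuting with `K`, parametrized
by `b`, and a complement, parametrized by `a`. Near `1` the map `(x, y, w) ↦ exp(a x) exp(b y) (1 +
w)`, `w` self-adjoint, straightens `U(n)`; near `K` the map `(x, ν) ↦ exp(a x) K exp(-a x) + ν`, `ν`
normal, straightens the orbit. That the second really does so rests on the compactness of `U(n)`:
the quotient embeds topologically onto the orbit, so orbit points near `K` come from group elements
near `1` (`exists_params`). Translating these charts gives atlases of `U(n)`, of the orbit, and,
through the orbit map, of the quotient. The projection then reads `(x, y) ↦ x`, and the bijection
between quotient and orbit is smooth both ways because both are smoothly embedded in `End V`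
(`exists_smooth_structures`). -/

namespace Twistor

open Set Topology

/-! ### Submanifold charts from slice parametrizations -/

section SliceAtlas

/-- A family of local parametrizations of a normed space `E` by `F × N`, smooth with smooth inverse,
which straighten the subset `S` of `E` to `F × {0}` and whose images cover `S`. -/
structure SliceAtlas {E : Type*} [NormedAddCommGroup E] [NormedSpace ℝ E] (S : Set E) (A : Type*)
    (F N : Type*) [NormedAddCommGroup F] [NormedSpace ℝ F] [NormedAddCommGroup N]
    [NormedSpace ℝ N] where
  /-- an identification of `E` with the model space -/
  equiv : (F × N) ≃L[ℝ] E
  /-- the parametrizations -/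
  param : A → OpenPartialHomeomorph (F × N) E
  contDiffOn_param : ∀ a, ContDiffOn ℝ ∞ (param a) (param a).source
  contDiffOn_symm : ∀ a, ContDiffOn ℝ ∞ (param a).symm (param a).target
  param_mem_iff : ∀ a, ∀ p ∈ (param a).source, param a p ∈ S ↔ p.2 = 0
  cover : ∀ y ∈ S, ∃ a, y ∈ (param a).target

namespace SliceAtlas

variable {E : Type*} [NormedAddCommGroup E] [NormedSpace ℝ E] {S : Set E} {A : Type*}
  {F N : Type*} [NormedAddCommGroup F] [NormedSpace ℝ F] [NormedAddCommGroup N] [NormedSpace ℝ N]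
  (s : SliceAtlas S A F N)

theorem symm_snd {a : A} {y : E} (hy : y ∈ (s.param a).target) (hS : y ∈ S) :
    ((s.param a).symm y).2 = 0 := by
  rw [← s.param_mem_iff a _ ((s.param a).map_target hy), (s.param a).right_inv hy]
  exact hS

theorem param_fst_zero {a : A} {y : E} (hy : y ∈ (s.param a).target) (hS : y ∈ S) :
    s.param a (((s.param a).symm y).1, 0) = y := by
  rw [← s.symm_snd hy hS, Prod.mk.eta, (s.param a).right_inv hy]

variable {X : Type*} [TopologicalSpace X] {i : X → E} (hi : IsEmbedding i)
  (hr : range i = S)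

/-- The chart given by a parametrization, on a space `X` homeomorphic to `S`. -/
noncomputable def chart [Nonempty X] (a : A) : OpenPartialHomeomorph X F where
  toFun x := ((s.param a).symm (i x)).1
  invFun p := Function.invFun i (s.param a (p, 0))
  source := i ⁻¹' (s.param a).target
  target := (fun p : F => (p, (0 : N))) ⁻¹' (s.param a).source
  map_source' x hx := by
    have := (s.param a).map_target hx
    rwa [← Prod.mk.eta (p := (s.param a).symm (i x)),
      s.symm_snd hx (hr.subset (mem_range_self x))] at this
  map_target' p hp := by
    have h : s.param a (p, 0) ∈ range i := hr ▸ (s.param_mem_iff a _ hp).2 rfl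
    simpa only [mem_preimage, Function.invFun_eq h] using (s.param a).map_source hp
  left_inv' x hx := by
    rw [s.param_fst_zero hx (hr.subset (mem_range_self x)),
      Function.leftInverse_invFun hi.injective]
  right_inv' p hp := by
    have h : s.param a (p, 0) ∈ range i := hr ▸ (s.param_mem_iff a _ hp).2 rfl
    rw [Function.invFun_eq h, (s.param a).left_inv hp]
  open_source := (s.param a).open_target.preimage hi.continuous
  open_target := (s.param a).open_source.preimage (by fun_prop)
  continuousOn_toFun := continuous_fst.comp_continuousOn
    ((s.param a).continuousOn_symm.comp hi.continuous.continuousOn fun _ h => h)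
  continuousOn_invFun := by
    rw [hi.continuousOn_iff]
    refine ContinuousOn.congr (f := fun p => s.param a (p, 0)) ?_ fun p hp =>
      Function.invFun_eq (hr ▸ (s.param_mem_iff a _ hp).2 rfl)
    exact (s.param a).continuousOn.comp (by fun_prop) fun _ h => h

theorem chart_apply [Nonempty X] (a : A) (x : X) :
    s.chart hi hr a x = ((s.param a).symm (i x)).1 := rfl

theorem mem_chart_source [Nonempty X] {a : A} {x : X} :
    x ∈ (s.chart hi hr a).source ↔ i x ∈ (s.param a).target := Iff.rfl

theorem incl_chart_symm [Nonempty X] {a : A} {p : F} (hp : p ∈ (s.chart hi hr a).target) :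
    i ((s.chart hi hr a).symm p) = s.param a (p, 0) :=
  Function.invFun_eq (hr ▸ (s.param_mem_iff a _ hp).2 rfl)

/-- The charted space structure given by the charts of a slice atlas. -/
@[reducible]
noncomputable def chartedSpace [Nonempty X] : ChartedSpace F X where
  atlas := range (s.chart hi hr)
  chartAt x := s.chart hi hr (s.cover (i x) (hr.subset (mem_range_self x))).choose
  mem_chart_source x := (s.cover (i x) (hr.subset (mem_range_self x))).choose_spec
  chart_mem_atlas _ := mem_range_self _

/-- Chart changes are `(param b).symm ∘ param a` restricted to `F × {0}` and followed by the first
projection. -/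
theorem isManifold [Nonempty X] :
    letI := s.chartedSpace hi hr
    IsManifold 𝓘(ℝ, F) ∞ X := by
  let _ := s.chartedSpace hi hr
  refine isManifold_of_contDiffOn _ _ _ ?_
  rintro _ _ ⟨a, rfl⟩ ⟨b, rfl⟩
  simp only [modelWithCornersSelf_coe, Function.id_comp, modelWithCornersSelf_coe_symm,
    Function.comp_id, preimage_id, range_id, inter_univ, OpenPartialHomeomorph.coe_trans]
  have key : ContDiffOn ℝ ∞ (fun p : F => ((s.param b).symm (s.param a (p, 0))).1)
      ((s.chart hi hr a).symm.trans (s.chart hi hr b)).source := by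
    refine contDiff_fst.comp_contDiffOn ((s.contDiffOn_symm b).comp ((s.contDiffOn_param a).comp
      (contDiff_id.prodMk contDiff_const).contDiffOn ?_) ?_)
    · intro p hp
      exact hp.1
    · intro p hp
      have h := hp.2
      rw [mem_preimage, mem_chart_source, OpenPartialHomeomorph.symm_symm] at h
      change s.param a (p, 0) ∈ (s.param b).target
      rw [← incl_chart_symm s hi hr hp.1]
      exact h
  refine key.congr fun p hp => ?_
  rw [Function.comp_apply, chart_apply, incl_chart_symm s hi hr hp.1]

theorem chart_mem_maximalAtlas [Nonempty X] (a : A) :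
    letI := s.chartedSpace hi hr
    s.chart hi hr a ∈ IsManifold.maximalAtlas 𝓘(ℝ, F) ∞ X := by
  let _ := s.chartedSpace hi hr
  have := s.isManifold hi hr
  exact IsManifold.subset_maximalAtlas (mem_range_self a)

/-- Charts of `E` take values in `E`, not in `F × N`; this is what the field `equiv` is for. -/
theorem param_symm_mem_maximalAtlas (a : A) :
    ((s.param a).symm.trans s.equiv.toHomeomorph.toOpenPartialHomeomorph) ∈
      IsManifold.maximalAtlas 𝓘(ℝ, E) ∞ E := by
  refine StructureGroupoid.mem_maximalAtlas_of_mem_groupoid _ ?_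
  rw [contDiffGroupoid, mem_groupoid_of_pregroupoid]
  constructor
  · have : ContDiffOn ℝ ∞ (s.equiv ∘ (s.param a).symm) (s.param a).target :=
      s.equiv.contDiff.comp_contDiffOn (s.contDiffOn_symm a)
    simpa [contDiffPregroupoid] using this
  · have : ContDiffOn ℝ ∞ ((s.param a) ∘ s.equiv.symm) (s.equiv.symm ⁻¹' (s.param a).source) :=
      (s.contDiffOn_param a).comp s.equiv.symm.contDiff.contDiffOn fun _ h => h
    simpa [contDiffPregroupoid] using this

/-- In the chart of `X` and the inverse parametrization on `E`, the map `i` reads `p ↦ (p, 0)`.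
Keeping `i` general lets one atlas serve both the orbit, with its inclusion, and the quotient, with
the orbit map. -/
theorem isSmoothEmbedding [Nonempty X] :
    letI := s.chartedSpace hi hr
    Manifold.IsSmoothEmbedding 𝓘(ℝ, F) 𝓘(ℝ, E) ∞ i := by
  let _ := s.chartedSpace hi hr
  have := s.isManifold hi hr
  refine ⟨Manifold.IsImmersionOfComplement.isImmersion (F := N) fun x => ?_, hi⟩
  obtain ⟨a, ha⟩ := s.cover (i x) (hr.subset (mem_range_self x))
  refine Manifold.IsImmersionAtOfComplement.mk_of_charts s.equiv (s.chart hi hr a)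
    ((s.param a).symm.trans s.equiv.toHomeomorph.toOpenPartialHomeomorph) ha ?_
    (s.chart_mem_maximalAtlas hi hr a) (s.param_symm_mem_maximalAtlas a) ?_ ?_
  · simpa using ha
  · intro y hy
    simpa using (s.mem_chart_source hi hr).1 hy
  · intro p hp
    have hp' : p ∈ (s.chart hi hr a).target := by simpa using hp
    have : (s.param a).symm (i ((s.chart hi hr a).symm p)) = (p, 0) := by
      rw [s.incl_chart_symm hi hr hp', (s.param a).left_inv hp']
    simpa using this

end SliceAtlas

end SliceAtlas

end Twistor

namespace Twistor

open Set Topology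

/-! ### The inverse function theorem on a neighbourhood -/

section InverseFunction

variable {E F : Type*} [NormedAddCommGroup E] [NormedSpace ℝ E] [NormedAddCommGroup F]
  [NormedSpace ℝ F]

/-- The inverse function theorem: a smooth map with invertible derivative at a point restricts to a
diffeomorphism from an arbitrarily small neighbourhood of that point onto its image. -/
theorem exists_openPartialHomeomorph [CompleteSpace E] {f : E → F} (hf : ContDiff ℝ ∞ f) {a : E}
    {f' : E ≃L[ℝ] F} (hf' : HasFDerivAt f (f' : E →L[ℝ] F) a) {U : Set E} (hU : U ∈ 𝓝 a) :
    ∃ P : OpenPartialHomeomorph E F, a ∈ P.source ∧ P.source ⊆ U ∧ (∀ x, P x = f x) ∧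
      ContDiffOn ℝ ∞ P P.source ∧ ContDiffOn ℝ ∞ P.symm P.target := by
  have hn : (∞ : WithTop ℕ∞) ≠ 0 := by simp
  let P₀ := hf.contDiffAt.toOpenPartialHomeomorph f hf' hn
  -- Staying where the derivative is invertible makes the inverse smooth on the whole target, not
  -- only at `f a`.
  let W : Set E := fderiv ℝ f ⁻¹' range ((↑) : (E ≃L[ℝ] F) → E →L[ℝ] F)
  have hW : IsOpen W := (ContinuousLinearEquiv.isOpen).preimage (hf.continuous_fderiv hn)
  have haW : a ∈ W := ⟨f', hf'.fderiv.symm⟩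
  let s : Set E := W ∩ interior U
  have hs : IsOpen s := hW.inter isOpen_interior
  let P := P₀.restrOpen s hs
  have hPf : ∀ x, P x = f x := fun _ => rfl
  have hsrc : P.source = P₀.source ∩ s := rfl
  refine ⟨P, ?_, ?_, hPf, hf.contDiffOn, ?_⟩
  · rw [hsrc]
    exact ⟨hf.contDiffAt.mem_toOpenPartialHomeomorph_source hf' hn,
      haW, mem_interior_iff_mem_nhds.2 hU⟩
  · rw [hsrc]
    exact fun x hx => interior_subset hx.2.2
  · intro y hy
    have hx := P.map_target hy
    rw [hsrc] at hx
    obtain ⟨g, hg⟩ := hx.2.1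
    refine (P.contDiffAt_symm hy (f₀' := g) ?_ hf.contDiffAt).contDiffWithinAt
    rw [hg]
    exact (hf.differentiable hn _).hasFDerivAt

/-- The composition of a partial diffeomorphism with a linear automorphism of the target. -/
theorem contDiffOn_transHomeomorph {P : OpenPartialHomeomorph E F} (T : F ≃L[ℝ] F)
    (h : ContDiffOn ℝ ∞ P P.source) (h' : ContDiffOn ℝ ∞ P.symm P.target) :
    ContDiffOn ℝ ∞ (P.transHomeomorph T.toHomeomorph) (P.transHomeomorph T.toHomeomorph).source ∧
      ContDiffOn ℝ ∞ (P.transHomeomorph T.toHomeomorph).symm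
        (P.transHomeomorph T.toHomeomorph).target :=
  ⟨T.contDiff.comp_contDiffOn h, h'.comp T.symm.contDiff.contDiffOn fun _ hx => hx⟩

end InverseFunction

/-! ### The matrix exponential and compactness of `U(n)` -/

section MatrixExponential

variable {n : ℕ}

open NormedSpace Matrix

/-- The star algebra of operators on `ℂⁿ`, identified with matrices as a real vector space. -/
noncomputable def matrixCLE (n : ℕ) : Matrix (Fin n) (Fin n) ℂ ≃L[ℝ]
    (EuclideanSpace ℂ (Fin n) →L[ℂ] EuclideanSpace ℂ (Fin n)) :=
  ((toEuclideanCLM (n := Fin n) (𝕜 := ℂ)).toAlgEquiv.toLinearEquiv.restrictScalars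
    ℝ).toContinuousLinearEquiv

theorem matrix_exp_eq (X : Matrix (Fin n) (Fin n) ℂ) :
    exp X = (matrixCLE n).symm (exp (matrixCLE n X)) := by
  rw [exp_eq_tsum ℝ, exp_eq_tsum ℝ]
  simp only
  rw [(matrixCLE n).symm.map_tsum]
  refine tsum_congr fun k => ?_
  rw [map_smul]
  congr 1
  refine ((matrixCLE n).symm_apply_eq.2 ?_).symm
  exact (map_pow (toEuclideanCLM (n := Fin n) (𝕜 := ℂ)) X k).symm

/-- The elementwise norm is not submultiplicative, so analyticity is transported from the Banach
algebra of operators on `ℂⁿ`. -/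
theorem contDiff_matrix_exp :
    ContDiff ℝ ∞ (exp : Matrix (Fin n) (Fin n) ℂ → Matrix (Fin n) (Fin n) ℂ) := by
  have : (exp : Matrix (Fin n) (Fin n) ℂ → Matrix (Fin n) (Fin n) ℂ) =
      (matrixCLE n).symm ∘ exp ∘ matrixCLE n := funext matrix_exp_eq
  rw [this]
  refine (matrixCLE n).symm.contDiff.comp (ContDiff.comp ?_ (matrixCLE n).contDiff)
  exact contDiff_iff_contDiffAt.2 fun x => (exp_analytic (𝕂 := ℝ) x).contDiffAt

theorem hasFDerivAt_matrix_exp_zero :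
    HasFDerivAt (exp : Matrix (Fin n) (Fin n) ℂ → Matrix (Fin n) (Fin n) ℂ)
      (ContinuousLinearMap.id ℝ _) 0 := by
  have h : (exp : Matrix (Fin n) (Fin n) ℂ → Matrix (Fin n) (Fin n) ℂ) =
      (matrixCLE n).symm ∘ exp ∘ matrixCLE n := funext matrix_exp_eq
  rw [h]
  have h1 : HasFDerivAt (exp : (EuclideanSpace ℂ (Fin n) →L[ℂ] EuclideanSpace ℂ (Fin n)) → _)
      (1 : _ →L[ℝ] _) (matrixCLE n 0) := by
    rw [map_zero]
    exact hasFDerivAt_exp_zero (𝕂 := ℝ)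
  have h2 := (matrixCLE n).symm.hasFDerivAt.comp (0 : Matrix (Fin n) (Fin n) ℂ)
    (h1.comp 0 (matrixCLE n).hasFDerivAt)
  exact h2.congr_fderiv (ContinuousLinearMap.ext (matrixCLE n).symm_apply_apply)

theorem exp_mem_unitaryGroup {X : Matrix (Fin n) (Fin n) ℂ} (hX : star X = -X) :
    exp X ∈ unitaryGroup (Fin n) ℂ := by
  rw [mem_unitaryGroup_iff, star_exp, hX,
    ← Matrix.exp_add_of_commute _ _ (Commute.refl X).neg_right,
    add_neg_cancel, exp_zero]

/-- An algebra map out of a finite-dimensional space is continuous, hence passes through the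
exponential series. -/
theorem map_matrix_exp {B : Type*} [NormedRing B] [NormedAlgebra ℝ B]
    (α : Matrix (Fin n) (Fin n) ℂ →ₐ[ℝ] B) (X : Matrix (Fin n) (Fin n) ℂ) :
    α (exp X) = exp (α X) := by
  let _ : Algebra ℚ B := Algebra.compHom B (algebraMap ℚ ℝ)
  let f : (EuclideanSpace ℂ (Fin n) →L[ℂ] EuclideanSpace ℂ (Fin n)) →+* B :=
    α.toRingHom.comp (toEuclideanCLM (n := Fin n) (𝕜 := ℂ)).symm.toRingEquiv.toRingHom
  have hα : Continuous α := α.toLinearMap.continuous_of_finiteDimensional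
  have hf : Continuous f := hα.comp (matrixCLE n).symm.continuous
  let _ : NormedAlgebra ℚ (EuclideanSpace ℂ (Fin n) →L[ℂ] EuclideanSpace ℂ (Fin n)) :=
    NormedAlgebra.restrictScalars ℚ ℂ _
  have h := map_exp f hf (matrixCLE n X)
  rw [matrix_exp_eq]
  refine h.trans ?_
  congr 1
  exact congrArg α ((matrixCLE n).symm_apply_apply X)

theorem isCompact_unitaryGroup :
    IsCompact (unitaryGroup (Fin n) ℂ : Set (Matrix (Fin n) (Fin n) ℂ)) := by
  refine Metric.isCompact_of_isClosed_isBounded ?_ ?_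
  · have : (unitaryGroup (Fin n) ℂ : Set (Matrix (Fin n) (Fin n) ℂ)) =
        {A | A * star A = 1} := by
      ext A
      exact mem_unitaryGroup_iff
    rw [this]
    exact isClosed_eq (by fun_prop) continuous_const
  · exact isBounded_iff_forall_norm_le.2 ⟨1, fun A hA => entrywise_sup_norm_bound_of_unitary hA⟩

instance : CompactSpace (unitaryGroup (Fin n) ℂ) :=
  isCompact_iff_compactSpace.1 isCompact_unitaryGroup

end MatrixExponential

end Twistor

namespace Twistor

open Set Topology

/-! ### Moving one slice chart around by linear symmetries -/

section SliceParam

variable {E : Type*} [NormedAddCommGroup E] [NormedSpace ℝ E]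
  {F N : Type*} [NormedAddCommGroup F] [NormedSpace ℝ F] [NormedAddCommGroup N] [NormedSpace ℝ N]

/-- A local parametrization of `E` by `F × N`, smooth with smooth inverse, which straightens `S`. -/
structure SliceParam (S : Set E) (F N : Type*) [NormedAddCommGroup F] [NormedSpace ℝ F]
    [NormedAddCommGroup N] [NormedSpace ℝ N] where
  /-- the underlying partial homeomorphism -/
  param : OpenPartialHomeomorph (F × N) E
  contDiffOn_param : ContDiffOn ℝ ∞ param param.source
  contDiffOn_symm : ContDiffOn ℝ ∞ param.symm param.target
  param_mem_iff : ∀ p ∈ param.source, param p ∈ S ↔ p.2 = 0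

theorem exists_sliceParam [FiniteDimensional ℝ F] [FiniteDimensional ℝ N] {S : Set E}
    {f : F × N → E} (hf : ContDiff ℝ ∞ f) {f' : (F × N) ≃L[ℝ] E}
    (hf' : HasFDerivAt f (f' : F × N →L[ℝ] E) 0) {U : Set (F × N)} (hU : U ∈ 𝓝 0)
    (hS : ∀ p ∈ U, f p ∈ S ↔ p.2 = 0) :
    ∃ P : SliceParam S F N, 0 ∈ P.param.source ∧ ∀ p, P.param p = f p := by
  have : CompleteSpace (F × N) := FiniteDimensional.complete ℝ _
  obtain ⟨P, h0, hPU, hP, hP1, hP2⟩ := exists_openPartialHomeomorph hf hf' hU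
  exact ⟨⟨P, hP1, hP2, fun p hp => by rw [hP]; exact hS p (hPU hp)⟩, h0, hP⟩

/-- The restriction of a parametrization to an open set. -/
def SliceParam.restrict {S : Set E} (P : SliceParam S F N) (W : Set (F × N)) (hW : IsOpen W) :
    SliceParam S F N where
  param := P.param.restrOpen W hW
  contDiffOn_param := P.contDiffOn_param.mono inter_subset_left
  contDiffOn_symm := P.contDiffOn_symm.mono inter_subset_left
  param_mem_iff p hp := P.param_mem_iff p hp.1

/-- A slice atlas obtained by moving a single parametrization with linear automorphisms of the
ambient space that preserve `S`. -/
def SliceParam.sliceAtlas {S : Set E} {A : Type*} (P : SliceParam S F N)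
    (equiv : (F × N) ≃L[ℝ] E) (T : A → E ≃L[ℝ] E) (hT : ∀ a y, T a y ∈ S ↔ y ∈ S)
    (hcover : ∀ y ∈ S, ∃ a, ∃ z ∈ P.param.target, T a z = y) :
    SliceAtlas S A F N where
  equiv := equiv
  param a := P.param.transHomeomorph (T a).toHomeomorph
  contDiffOn_param a := (contDiffOn_transHomeomorph (T a) P.contDiffOn_param P.contDiffOn_symm).1
  contDiffOn_symm a := (contDiffOn_transHomeomorph (T a) P.contDiffOn_param P.contDiffOn_symm).2
  param_mem_iff a p hp := (hT a (P.param p)).trans (P.param_mem_iff p hp)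
  cover y hy := by
    obtain ⟨a, z, hz, rfl⟩ := hcover y hy
    refine ⟨a, ?_⟩
    change (T a).symm (T a z) ∈ P.param.target
    rwa [(T a).symm_apply_apply]

end SliceParam

open NormedSpace Matrix

variable {n : ℕ}

section MatrixMul

/-- Multiplication of matrices as a continuous bilinear map. -/
noncomputable def matrixMulCLM (n : ℕ) :
    Matrix (Fin n) (Fin n) ℂ →L[ℝ] Matrix (Fin n) (Fin n) ℂ →L[ℝ] Matrix (Fin n) (Fin n) ℂ :=
  (LinearMap.mul ℝ (Matrix (Fin n) (Fin n) ℂ)).toContinuousBilinearMap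

variable {E : Type*} [NormedAddCommGroup E] [NormedSpace ℝ E] {f g : E → Matrix (Fin n) (Fin n) ℂ}

theorem contDiff_matrix_mul (hf : ContDiff ℝ ∞ f) (hg : ContDiff ℝ ∞ g) :
    ContDiff ℝ ∞ fun x => f x * g x :=
  ((matrixMulCLM n).isBoundedBilinearMap.contDiff (n := ∞)).comp (hf.prodMk hg)

theorem hasFDerivAt_matrix_mul {f' g' : E →L[ℝ] Matrix (Fin n) (Fin n) ℂ} {x : E}
    (hf : HasFDerivAt f f' x) (hg : HasFDerivAt g g' x) (hfx : f x = 1) (hgx : g x = 1) :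
    HasFDerivAt (fun x => f x * g x) (f' + g') x := by
  refine ((matrixMulCLM n).hasFDerivAt_of_bilinear hf hg).congr_fderiv ?_
  refine ContinuousLinearMap.ext fun v => ?_
  rw [hfx, hgx]
  change 1 * g' v + f' v * 1 = f' v + g' v
  rw [one_mul, mul_one, add_comm]

end MatrixMul

/-! ### Splitting matrices along the infinitesimal stabilizer of `K` -/

section Splitting

variable {B : Type*} [NormedRing B] [NormedAlgebra ℝ B]
  (α : Matrix (Fin n) (Fin n) ℂ →ₐ[ℝ] B) (K : B)

/-- A decomposition of the space of matrices into the self-adjoint ones and the skew-adjoint ones,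
with the latter split into those which act on `K` by commutation (`b`) and a complement (`a`). -/
structure Splitting (G F F' : Type*) [NormedAddCommGroup G] [NormedSpace ℝ G]
    [NormedAddCommGroup F] [NormedSpace ℝ F] [NormedAddCommGroup F'] [NormedSpace ℝ F'] where
  /-- the coordinates on skew-adjoint matrices -/
  q : G ≃L[ℝ] F × F'
  /-- the complement -/
  a : F →L[ℝ] Matrix (Fin n) (Fin n) ℂ
  /-- the skew-adjoint matrices commuting with `K` -/
  b : F' →L[ℝ] Matrix (Fin n) (Fin n) ℂ
  /-- the splitting -/
  L : (G × selfAdjoint.submodule ℝ (Matrix (Fin n) (Fin n) ℂ)) ≃L[ℝ] Matrix (Fin n) (Fin n) ℂ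
  L_apply : ∀ p, L p = a (q p.1).1 + b (q p.1).2 + p.2
  star_a : ∀ x, star (a x) = -a x
  star_b : ∀ y, star (b y) = -b y
  commute_b : ∀ y, Commute (α (b y)) K
  eq_zero_of_commute_a : ∀ x, Commute (α (a x)) K → x = 0

theorem exists_splitting : ∃ c d d' : ℕ, Nonempty (Splitting α K (EuclideanSpace ℝ (Fin c))
    (EuclideanSpace ℝ (Fin d)) (EuclideanSpace ℝ (Fin d'))) := by
  let M := Matrix (Fin n) (Fin n) ℂ
  let D : M →ₗ[ℝ] B := (LinearMap.mulRight ℝ K - LinearMap.mulLeft ℝ K) ∘ₗ α.toLinearMap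
  have hD : ∀ X, D X = 0 ↔ Commute (α X) K := fun X => by
    simp [D, sub_eq_zero, Commute, SemiconjBy]
  let u : Submodule ℝ M := skewAdjoint.submodule ℝ M
  let p : Submodule ℝ M := selfAdjoint.submodule ℝ M
  have hu : ∀ {X : M}, X ∈ u ↔ star X = -X := skewAdjoint.mem_iff
  have hp : ∀ {X : M}, X ∈ p ↔ star X = X := selfAdjoint.mem_iff
  let h : Submodule ℝ M := u ⊓ LinearMap.ker D
  -- `C` is a complement of `h` among all matrices; because `h ≤ u`, its intersection `m` with `u`
  -- is a complement of `h` in `u` (modular law).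
  obtain ⟨C, hC⟩ := h.exists_isCompl
  let m : Submodule ℝ M := C ⊓ u
  let c := Module.finrank ℝ m + Module.finrank ℝ h
  let eF := toEuclidean (E := m)
  let eF' := toEuclidean (E := h)
  -- Charts of `U(n)` must have a single Euclidean space as model, so the product is replaced by one
  -- of the same dimension.
  let q : EuclideanSpace ℝ (Fin c) ≃L[ℝ] EuclideanSpace ℝ (Fin (Module.finrank ℝ m)) ×
    EuclideanSpace ℝ (Fin (Module.finrank ℝ h)) := ContinuousLinearEquiv.ofFinrankEq (by simp [c])
  let a : EuclideanSpace ℝ (Fin (Module.finrank ℝ m)) →L[ℝ] M := m.subtypeL ∘L eF.symm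
  let b : EuclideanSpace ℝ (Fin (Module.finrank ℝ h)) →L[ℝ] M := h.subtypeL ∘L eF'.symm
  have ha : ∀ x, a x ∈ C ∧ a x ∈ u := fun x => (eF.symm x).2
  have hb : ∀ y, b y ∈ u ∧ b y ∈ LinearMap.ker D := fun y => (eF'.symm y).2
  let L₀ : (EuclideanSpace ℝ (Fin c) × p) →ₗ[ℝ] M :=
    (a.toLinearMap ∘ₗ LinearMap.fst ℝ _ _ ∘ₗ q.toLinearMap ∘ₗ LinearMap.fst ℝ _ _) +
    (b.toLinearMap ∘ₗ LinearMap.snd ℝ _ _ ∘ₗ q.toLinearMap ∘ₗ LinearMap.fst ℝ _ _) +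
    p.subtype ∘ₗ LinearMap.snd ℝ _ _
  have hL₀ : ∀ z, L₀ z = a (q z.1).1 + b (q z.1).2 + z.2 := fun z => rfl
  have hcancel : ∀ {X : M}, X ∈ u → X ∈ p → X = 0 := fun {X} h1 h2 => by
    have h3 : X = -X := (hp.1 h2).symm.trans (hu.1 h1)
    have h4 : (2 : ℝ) • X = 0 := by rw [two_smul, ← eq_neg_iff_add_eq_zero, ← h3]
    exact (smul_eq_zero.1 h4).resolve_left two_ne_zero
  have hinj : Function.Injective L₀ := by
    rw [injective_iff_map_eq_zero]
    intro z hz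
    rw [hL₀] at hz
    have hsu : a (q z.1).1 + b (q z.1).2 ∈ u := add_mem (ha _).2 (hb _).1
    have hsp : a (q z.1).1 + b (q z.1).2 ∈ p := by
      rw [eq_neg_of_add_eq_zero_left hz]
      exact neg_mem z.2.2
    have h0 := hcancel hsu hsp
    rw [h0, zero_add] at hz
    have hax : a (q z.1).1 ∈ h := by
      rw [eq_neg_of_add_eq_zero_left h0]
      exact neg_mem (hb _)
    have ha0 : a (q z.1).1 = 0 := Submodule.disjoint_def.1 hC.disjoint _ hax (ha _).1
    rw [ha0, zero_add] at h0
    have h1 : (q z.1).1 = 0 := by simpa [a] using ha0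
    have h2 : (q z.1).2 = 0 := by simpa [b] using h0
    have h3 : q z.1 = 0 := Prod.ext h1 h2
    exact Prod.ext (by simpa using h3) (Subtype.ext hz)
  have hsurj : Function.Surjective L₀ := by
    intro X
    have hX := StarModule.selfAdjointPart_add_skewAdjointPart ℝ X
    obtain ⟨Y, hY, Z, hZ, hYZ⟩ := Submodule.mem_sup.1
      (hC.sup_eq_top ▸ Submodule.mem_top : (skewAdjointPart ℝ X : M) ∈ h ⊔ C)
    have hZu : Z ∈ u := by
      rw [← add_sub_cancel_left Y Z, hYZ]
      exact sub_mem (skewAdjointPart ℝ X).2 hY.1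
    refine ⟨(q.symm (eF ⟨Z, hZ, hZu⟩, eF' ⟨Y, hY⟩), selfAdjointPart ℝ X), ?_⟩
    rw [hL₀]
    simp only [ContinuousLinearEquiv.apply_symm_apply, a, b, ContinuousLinearMap.comp_apply,
      ContinuousLinearEquiv.coe_coe, ContinuousLinearEquiv.symm_apply_apply,
      Submodule.subtypeL_apply]
    rw [add_comm Z, hYZ, add_comm, hX]
  exact ⟨c, _, _, ⟨{
    q := q
    a := a
    b := b
    L := (LinearEquiv.ofBijective L₀ ⟨hinj, hsurj⟩).toContinuousLinearEquiv
    L_apply := fun z => rfl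
    star_a := fun x => hu.1 (ha x).2
    star_b := fun y => hu.1 (hb y).1
    commute_b := fun y => (hD _).1 (hb y).2
    eq_zero_of_commute_a := fun x hx => by
      have : a x ∈ h := ⟨(ha x).2, (hD _).2 hx⟩
      simpa [a] using Submodule.disjoint_def.1 hC.disjoint _ this (ha x).1 }⟩⟩

end Splitting

end Twistor

namespace Twistor

open Set Topology NormedSpace Matrix

variable {n : ℕ}

/-! ### Exponential coordinates on `U(n)` and on the orbit -/

namespace Splitting

variable {B : Type*} [NormedRing B] [NormedAlgebra ℝ B]
  {α : Matrix (Fin n) (Fin n) ℂ →ₐ[ℝ] B} {K : B}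
  {G F F' : Type*} [NormedAddCommGroup G] [NormedSpace ℝ G]
  [NormedAddCommGroup F] [NormedSpace ℝ F] [NormedAddCommGroup F'] [NormedSpace ℝ F']
  (s : Splitting α K G F F')

/-- The unitary matrix `exp (a x)`. -/
noncomputable def expA (x : F) : unitaryGroup (Fin n) ℂ :=
  ⟨exp (s.a x), exp_mem_unitaryGroup (s.star_a x)⟩

/-- The unitary matrix `exp (b y)`. -/
noncomputable def expB (y : F') : unitaryGroup (Fin n) ℂ :=
  ⟨exp (s.b y), exp_mem_unitaryGroup (s.star_b y)⟩

theorem coe_expA (x : F) : (s.expA x : Matrix (Fin n) (Fin n) ℂ) = exp (s.a x) := rfl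

theorem coe_expB (y : F') : (s.expB y : Matrix (Fin n) (Fin n) ℂ) = exp (s.b y) := rfl

theorem coe_expA_inv (x : F) :
    ((s.expA x)⁻¹ : unitaryGroup (Fin n) ℂ).1 = exp (s.a (-x)) := by
  change star (exp (s.a x)) = _
  rw [star_exp, s.star_a, map_neg]

theorem commute_expB (y : F') : Commute (α (s.expB y : Matrix (Fin n) (Fin n) ℂ)) K := by
  rw [coe_expB, map_matrix_exp]
  exact (s.commute_b y).exp_left

/-- The map `(x, y, w) ↦ exp (a x) exp (b y) (1 + w)`. -/
noncomputable def groupParam (p : G × selfAdjoint.submodule ℝ (Matrix (Fin n) (Fin n) ℂ)) :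
    Matrix (Fin n) (Fin n) ℂ :=
  exp (s.a (s.q p.1).1) * exp (s.b (s.q p.1).2) * (1 + p.2)

theorem groupParam_zero_right (z : G) :
    s.groupParam (z, 0) = ((s.expA (s.q z).1 * s.expB (s.q z).2 : unitaryGroup (Fin n) ℂ) :
      Matrix (Fin n) (Fin n) ℂ) := by
  simp [groupParam, coe_expA, coe_expB]

theorem groupParam_zero : s.groupParam 0 = 1 := by simp [groupParam]

theorem contDiff_groupParam : ContDiff ℝ ∞ s.groupParam := by
  refine contDiff_matrix_mul (contDiff_matrix_mul ?_ ?_) ?_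
  · exact contDiff_matrix_exp.comp (s.a.contDiff.comp (contDiff_fst.comp
      (s.q.contDiff.comp contDiff_fst)))
  · exact contDiff_matrix_exp.comp (s.b.contDiff.comp (contDiff_snd.comp
      (s.q.contDiff.comp contDiff_fst)))
  · exact contDiff_const.add ((selfAdjoint.submodule ℝ
      (Matrix (Fin n) (Fin n) ℂ)).subtypeL.contDiff.comp contDiff_snd)

/-- All three factors equal `1` at the origin, so their derivatives add up, and the sum is the
splitting itself. -/
theorem hasFDerivAt_groupParam : HasFDerivAt s.groupParam (s.L : _ →L[ℝ] _) 0 := by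
  let P := selfAdjoint.submodule ℝ (Matrix (Fin n) (Fin n) ℂ)
  let A : (G × P) →L[ℝ] Matrix (Fin n) (Fin n) ℂ :=
    s.a ∘L (ContinuousLinearMap.fst ℝ F F') ∘L (s.q : G →L[ℝ] F × F') ∘L
      (ContinuousLinearMap.fst ℝ G P)
  let A' : (G × P) →L[ℝ] Matrix (Fin n) (Fin n) ℂ :=
    s.b ∘L (ContinuousLinearMap.snd ℝ F F') ∘L (s.q : G →L[ℝ] F × F') ∘L
      (ContinuousLinearMap.fst ℝ G P)
  let A'' : (G × P) →L[ℝ] Matrix (Fin n) (Fin n) ℂ := P.subtypeL ∘L (ContinuousLinearMap.snd ℝ G P)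
  have hexp : ∀ T : (G × P) →L[ℝ] Matrix (Fin n) (Fin n) ℂ,
      HasFDerivAt (fun p => exp (T p)) T 0 := fun T => by
    have h0 : HasFDerivAt (exp : Matrix (Fin n) (Fin n) ℂ → _) (ContinuousLinearMap.id ℝ _) (T 0) := by
      rw [map_zero]
      exact hasFDerivAt_matrix_exp_zero
    exact h0.comp 0 T.hasFDerivAt
  have h := hasFDerivAt_matrix_mul (hasFDerivAt_matrix_mul (hexp A) (hexp A') (by simp) (by simp))
    (A''.hasFDerivAt.const_add 1) (by simp) (by simp)
  refine h.congr_fderiv (ContinuousLinearMap.ext fun p => ?_)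
  exact (s.L_apply p).symm

/-- Cancelling the unitary factors leaves the self-adjoint matrix `1 + w`, which is unitary iff `w
(2 + w) = 0`. The determinant condition, open and valid near `w = 0`, excludes other solutions such
as `w = -2`. -/
theorem groupParam_mem_iff {p : G × selfAdjoint.submodule ℝ (Matrix (Fin n) (Fin n) ℂ)}
    (hp : (2 + (p.2 : Matrix (Fin n) (Fin n) ℂ)).det ≠ 0) :
    s.groupParam p ∈ (unitaryGroup (Fin n) ℂ : Set (Matrix (Fin n) (Fin n) ℂ)) ↔ p.2 = 0 := by
  constructor
  · intro h
    let u := s.expA (s.q p.1).1 * s.expB (s.q p.1).2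
    have h1 : (u⁻¹).1 * s.groupParam p = 1 + p.2 := by
      change (u⁻¹).1 * (u.1 * (1 + p.2)) = _
      rw [← mul_assoc]
      have : (u⁻¹).1 * u.1 = 1 := congrArg Subtype.val (inv_mul_cancel u)
      rw [this, one_mul]
    have h2 : (1 + p.2 : Matrix (Fin n) (Fin n) ℂ) ∈ unitaryGroup (Fin n) ℂ :=
      h1 ▸ mul_mem (u⁻¹).2 h
    have h3 := mem_unitaryGroup_iff.1 h2
    have hs : star (p.2 : Matrix (Fin n) (Fin n) ℂ) = p.2 := selfAdjoint.mem_iff.1 p.2.2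
    rw [star_add, star_one, hs] at h3
    have h4 : (p.2 : Matrix (Fin n) (Fin n) ℂ) * (2 + p.2) = 0 := by
      have : (p.2 : Matrix (Fin n) (Fin n) ℂ) * (2 + p.2) = (1 + p.2) * (1 + p.2) - 1 := by
        noncomm_ring
      rw [this, h3, sub_self]
    have hdet : IsUnit (2 + (p.2 : Matrix (Fin n) (Fin n) ℂ)).det := isUnit_iff_ne_zero.2 hp
    refine Subtype.ext ?_
    rw [← Matrix.mul_nonsing_inv_cancel_right _ (p.2 : Matrix (Fin n) (Fin n) ℂ) hdet, h4,
      Matrix.zero_mul]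
    rfl
  · intro h
    rw [← Prod.mk.eta (p := p), h, groupParam_zero_right]
    exact Subtype.prop _

/-- The map `x ↦ exp (a x) · K · exp (-a x)`. -/
noncomputable def orbitCurve (x : F) : B :=
  α (exp (s.a x)) * K * α (exp (s.a (-x)))

theorem orbitCurve_zero : s.orbitCurve 0 = K := by simp [orbitCurve]

theorem contDiff_map_exp : ContDiff ℝ ∞ fun x => α (exp (s.a x)) :=
  (LinearMap.toContinuousLinearMap α.toLinearMap).contDiff.comp
    (contDiff_matrix_exp.comp s.a.contDiff)

theorem contDiff_orbitCurve : ContDiff ℝ ∞ s.orbitCurve :=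
  (s.contDiff_map_exp.mul contDiff_const).mul (s.contDiff_map_exp.comp contDiff_neg)

/-- The derivative `x ↦ [a x, K]` of the orbit map. -/
noncomputable def orbitDeriv : F →ₗ[ℝ] B :=
  (LinearMap.mulRight ℝ K - LinearMap.mulLeft ℝ K) ∘ₗ α.toLinearMap ∘ₗ s.a.toLinearMap

theorem orbitDeriv_apply (x : F) : s.orbitDeriv x = α (s.a x) * K - K * α (s.a x) := rfl

/-- The complement `a` misses the infinitesimal stabilizer, so `orbitCurve` is an immersion at `0`.
-/
theorem orbitDeriv_injective : Function.Injective s.orbitDeriv := by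
  rw [injective_iff_map_eq_zero]
  intro x hx
  exact s.eq_zero_of_commute_a x (sub_eq_zero.1 hx)

theorem hasFDerivAt_orbitCurve [FiniteDimensional ℝ F] :
    HasFDerivAt s.orbitCurve (LinearMap.toContinuousLinearMap s.orbitDeriv) 0 := by
  let D := LinearMap.toContinuousLinearMap α.toLinearMap ∘L s.a
  have h1 : HasFDerivAt (fun x => α (exp (s.a x))) D 0 := by
    have h0 : HasFDerivAt (exp : Matrix (Fin n) (Fin n) ℂ → _) (ContinuousLinearMap.id ℝ _)
        (s.a 0) := by
      rw [map_zero]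
      exact hasFDerivAt_matrix_exp_zero
    exact ((LinearMap.toContinuousLinearMap α.toLinearMap).hasFDerivAt).comp 0
      (h0.comp 0 s.a.hasFDerivAt)
  have h2 : HasFDerivAt (fun x => α (exp (s.a (-x)))) (-D) 0 := by
    have h0 : HasFDerivAt (fun x => α (exp (s.a x))) D (-(0 : F)) := by rwa [neg_zero]
    exact (h0.comp 0 (hasFDerivAt_id (𝕜 := ℝ) (0 : F)).neg).congr_fderiv
      (ContinuousLinearMap.ext fun x => by simp)
  refine ((h1.mul_const' K).mul' h2).congr_fderiv (ContinuousLinearMap.ext fun x => ?_)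
  have hD : D x = α (s.a x) := rfl
  simp [orbitDeriv_apply, hD, sub_eq_neg_add]

theorem exists_groupParam [FiniteDimensional ℝ G] :
    ∃ P : SliceParam (unitaryGroup (Fin n) ℂ : Set (Matrix (Fin n) (Fin n) ℂ)) G
      (selfAdjoint.submodule ℝ (Matrix (Fin n) (Fin n) ℂ)),
      0 ∈ P.param.source ∧ ∀ p, P.param p = s.groupParam p := by
  refine exists_sliceParam s.contDiff_groupParam s.hasFDerivAt_groupParam (U :=
    {p | (2 + (p.2 : Matrix (Fin n) (Fin n) ℂ)).det ≠ 0}) ?_ fun p hp => s.groupParam_mem_iff hp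
  refine IsOpen.mem_nhds (isOpen_ne_fun (by fun_prop) continuous_const) ?_
  have : (2 : Matrix (Fin n) (Fin n) ℂ) = Matrix.diagonal fun _ => 2 := by
    ext i j
    simp [Matrix.diagonal, Matrix.ofNat_apply]
  simp [this]

variable [FiniteDimensional ℝ B] [FiniteDimensional ℝ F]

/-- Adding a complement `N` of the image of `orbitDeriv` makes the derivative at the origin
bijective. That the orbit meets this chart only in the slice `ν = 0` is not local information;
`exists_params` supplies it. -/
theorem exists_orbitParam : ∃ (N : Submodule ℝ B) (_ : (F × N) ≃L[ℝ] B)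
    (P : OpenPartialHomeomorph (F × N) B), 0 ∈ P.source ∧
      (∀ p, P p = s.orbitCurve p.1 + p.2) ∧ ContDiffOn ℝ ∞ P P.source ∧
      ContDiffOn ℝ ∞ P.symm P.target := by
  obtain ⟨N, hN⟩ := (LinearMap.range s.orbitDeriv).exists_isCompl
  let e : (F × N) ≃L[ℝ] B := (((LinearEquiv.ofInjective _ s.orbitDeriv_injective).prodCongr
    (LinearEquiv.refl ℝ N)).trans (Submodule.prodEquivOfIsCompl _ _ hN)).toContinuousLinearEquiv
  have he : ∀ p, e p = s.orbitDeriv p.1 + p.2 := fun p => rfl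
  have hcd : ContDiff ℝ ∞ fun p : F × N => s.orbitCurve p.1 + p.2 :=
    (s.contDiff_orbitCurve.comp contDiff_fst).add (N.subtypeL.contDiff.comp contDiff_snd)
  have hd : HasFDerivAt (fun p : F × N => s.orbitCurve p.1 + p.2) (e : (F × N) →L[ℝ] B) 0 := by
    have h1 : HasFDerivAt (fun p : F × N => s.orbitCurve p.1)
        (LinearMap.toContinuousLinearMap s.orbitDeriv ∘L ContinuousLinearMap.fst ℝ F N) 0 :=
      HasFDerivAt.comp (g := s.orbitCurve) (f := Prod.fst) (0 : F × N) s.hasFDerivAt_orbitCurve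
        (ContinuousLinearMap.fst ℝ F N).hasFDerivAt
    refine (h1.add (N.subtypeL ∘L ContinuousLinearMap.snd ℝ F N).hasFDerivAt).congr_fderiv
      (ContinuousLinearMap.ext fun p => ?_)
    exact (he p).symm
  have : CompleteSpace (F × N) := FiniteDimensional.complete ℝ _
  obtain ⟨P, h0, -, hP, hP1, hP2⟩ := exists_openPartialHomeomorph hcd hd Filter.univ_mem
  exact ⟨N, e, P, h0, hP, hP1, hP2⟩

end Splitting

end Twistor

namespace Twistor

open Set Topology NormedSpace Matrix

variable {n : ℕ}

/-! ### The conjugation action and the orbit map -/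

section Conjugation

variable {B : Type*} [NormedRing B] [NormedAlgebra ℝ B]
  (α : Matrix (Fin n) (Fin n) ℂ →ₐ[ℝ] B)

theorem map_mul_map_inv (g : unitaryGroup (Fin n) ℂ) : α g.1 * α (g⁻¹).1 = 1 := by
  rw [← map_mul, ← map_one α]
  exact congrArg (fun u : unitaryGroup (Fin n) ℂ => α u.1) (mul_inv_cancel g)

theorem map_inv_mul_map (g : unitaryGroup (Fin n) ℂ) : α (g⁻¹).1 * α g.1 = 1 := by
  simpa using map_mul_map_inv α g⁻¹

/-- The action of a unitary matrix by conjugation. -/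
noncomputable def conjBy (g : unitaryGroup (Fin n) ℂ) (T : B) : B := α g.1 * T * α (g⁻¹).1

theorem conjBy_mul (g h : unitaryGroup (Fin n) ℂ) (T : B) :
    conjBy α (g * h) T = conjBy α g (conjBy α h T) := by
  have h1 : α (g * h).1 = α g.1 * α h.1 := map_mul α g.1 h.1
  have h2 : α ((g * h)⁻¹).1 = α (h⁻¹).1 * α (g⁻¹).1 := by
    rw [_root_.mul_inv_rev]
    exact map_mul α (h⁻¹).1 (g⁻¹).1
  simp only [conjBy, h1, h2, mul_assoc]

theorem conjBy_one (T : B) : conjBy α 1 T = T := by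
  have h : (1 : unitaryGroup (Fin n) ℂ).1 = 1 := rfl
  rw [conjBy, inv_one, h, map_one, one_mul, mul_one]

theorem conjBy_eq_self_iff {g : unitaryGroup (Fin n) ℂ} {T : B} :
    conjBy α g T = T ↔ Commute (α g.1) T := by
  constructor
  · intro h
    have := congrArg (· * α g.1) h
    rw [commute_iff_eq]
    simpa only [conjBy, mul_assoc, map_inv_mul_map, mul_one] using this
  · intro h
    rw [conjBy, h.eq, mul_assoc, map_mul_map_inv, mul_one]

/-- Conjugation by a unitary matrix as a continuous linear equivalence. -/
noncomputable def conjCLE (g : unitaryGroup (Fin n) ℂ) : B ≃L[ℝ] B where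
  toFun := conjBy α g
  invFun := conjBy α g⁻¹
  map_add' S T := by simp only [conjBy, mul_add, add_mul]
  map_smul' c T := by simp [conjBy]
  left_inv T := by rw [← conjBy_mul, inv_mul_cancel, conjBy_one]
  right_inv T := by rw [← conjBy_mul, mul_inv_cancel, conjBy_one]
  continuous_toFun := by unfold conjBy; fun_prop
  continuous_invFun := by unfold conjBy; fun_prop

theorem continuous_conjBy (K : B) : Continuous fun g => conjBy α g K := by
  have hα : Continuous α := α.toLinearMap.continuous_of_finiteDimensional
  exact ((hα.comp continuous_subtype_val).mul continuous_const).mul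
    (hα.comp (continuous_subtype_val.comp continuous_inv))

theorem conjBy_mem_range_iff (K : B) (g : unitaryGroup (Fin n) ℂ) (T : B) :
    conjBy α g T ∈ range (fun h => conjBy α h K) ↔ T ∈ range fun h => conjBy α h K := by
  constructor
  · rintro ⟨h, hh⟩
    refine ⟨g⁻¹ * h, ?_⟩
    simp only at hh ⊢
    rw [conjBy_mul, hh, ← conjBy_mul, inv_mul_cancel, conjBy_one]
  · rintro ⟨h, rfl⟩
    exact ⟨g * h, conjBy_mul α g h K⟩

variable {α} {K : B} {H : Subgroup (unitaryGroup (Fin n) ℂ)}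

theorem conjBy_eq_conjBy_iff (hH : ∀ g : unitaryGroup (Fin n) ℂ, g ∈ H ↔ Commute (α g.1) K)
    (g h : unitaryGroup (Fin n) ℂ) :
    conjBy α g K = conjBy α h K ↔ (g : unitaryGroup (Fin n) ℂ ⧸ H) = h := by
  rw [QuotientGroup.eq, hH, ← conjBy_eq_self_iff, conjBy_mul]
  constructor
  · intro h1
    rw [← h1, ← conjBy_mul, inv_mul_cancel, conjBy_one]
  · intro h1
    rw [← conjBy_one α (conjBy α h K), ← mul_inv_cancel g, conjBy_mul, h1]

/-- The map `U(n)/H → B`, `[g] ↦ g · K`, where `H` is the stabilizer of `K`. -/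
noncomputable def orbitMap (hH : ∀ g : unitaryGroup (Fin n) ℂ, g ∈ H ↔ Commute (α g.1) K) :
    unitaryGroup (Fin n) ℂ ⧸ H → B :=
  Quotient.lift (fun g => conjBy α g K) fun g h hgh =>
    (conjBy_eq_conjBy_iff hH g h).2 (Quotient.sound hgh)

variable (hH : ∀ g : unitaryGroup (Fin n) ℂ, g ∈ H ↔ Commute (α g.1) K)

theorem orbitMap_mk (g : unitaryGroup (Fin n) ℂ) : orbitMap hH g = conjBy α g K := rfl

theorem range_orbitMap : range (orbitMap hH) = range fun g => conjBy α g K :=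
  range_quot_lift _

/-- A continuous injection from a compact space to a Hausdorff one is a closed embedding;
injectivity holds because `H` is the whole stabilizer. -/
theorem isEmbedding_orbitMap : IsEmbedding (orbitMap hH) := by
  have hc : Continuous (orbitMap hH) := (continuous_conjBy α K).quotient_lift _
  have hi : Function.Injective (orbitMap hH) := by
    intro x y
    induction x using QuotientGroup.induction_on
    induction y using QuotientGroup.induction_on
    exact (conjBy_eq_conjBy_iff hH _ _).1
  have : CompactSpace (unitaryGroup (Fin n) ℂ ⧸ H) := Quotient.compactSpace
  exact (hc.isClosedEmbedding hi).isEmbedding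

end Conjugation

section LeftMul

/-- Left multiplication by a unitary matrix. -/
noncomputable def leftMulCLE (g : unitaryGroup (Fin n) ℂ) :
    Matrix (Fin n) (Fin n) ℂ ≃L[ℝ] Matrix (Fin n) (Fin n) ℂ :=
  LinearEquiv.toContinuousLinearEquiv
  { LinearMap.mulLeft ℝ g.1 with
    invFun := fun A => (g⁻¹).1 * A
    left_inv := fun A => by
      have h : (g⁻¹).1 * g.1 = 1 := congrArg Subtype.val (inv_mul_cancel g)
      change (g⁻¹).1 * (g.1 * A) = A
      rw [← mul_assoc, h, one_mul]
    right_inv := fun A => by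
      have h : g.1 * (g⁻¹).1 = 1 := congrArg Subtype.val (mul_inv_cancel g)
      change g.1 * ((g⁻¹).1 * A) = A
      rw [← mul_assoc, h, one_mul] }

theorem leftMulCLE_mem_iff (g : unitaryGroup (Fin n) ℂ) (A : Matrix (Fin n) (Fin n) ℂ) :
    leftMulCLE g A ∈ (unitaryGroup (Fin n) ℂ : Set (Matrix (Fin n) (Fin n) ℂ)) ↔
      A ∈ (unitaryGroup (Fin n) ℂ : Set (Matrix (Fin n) (Fin n) ℂ)) := by
  constructor
  · intro h
    rw [← (leftMulCLE g).symm_apply_apply A]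
    exact mul_mem (g⁻¹).2 h
  · intro h
    exact mul_mem g.2 h

end LeftMul

/-! ### Compatible slice charts at `1` and at `K` -/

namespace Splitting

variable {B : Type*} [NormedRing B] [NormedAlgebra ℝ B]
  {α : Matrix (Fin n) (Fin n) ℂ →ₐ[ℝ] B} {K : B}
  {G F F' : Type*} [NormedAddCommGroup G] [NormedSpace ℝ G]
  [NormedAddCommGroup F] [NormedSpace ℝ F] [NormedAddCommGroup F'] [NormedSpace ℝ F']
  (s : Splitting α K G F F')

theorem conjBy_expA (x : F) : conjBy α (s.expA x) K = s.orbitCurve x := by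
  rw [conjBy, coe_expA, coe_expA_inv, orbitCurve]

/-- `exp (b y)` commutes with `K`: the `y`-directions are the fibres of the orbit map. -/
theorem conjBy_expA_mul_expB (x : F) (y : F') :
    conjBy α (s.expA x * s.expB y) K = s.orbitCurve x := by
  rw [conjBy_mul, (conjBy_eq_self_iff α).2 (s.commute_expB y), conjBy_expA]

/-- Compatible parametrizations of `U(n)` and of the orbit of `K`. -/
theorem exists_params [FiniteDimensional ℝ B] [FiniteDimensional ℝ F] [FiniteDimensional ℝ G]
    {H : Subgroup (unitaryGroup (Fin n) ℂ)}
    (hH : ∀ g : unitaryGroup (Fin n) ℂ, g ∈ H ↔ Commute (α g.1) K) :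
    ∃ (N : Submodule ℝ B) (_ : (F × N) ≃L[ℝ] B)
      (P : SliceParam (unitaryGroup (Fin n) ℂ : Set (Matrix (Fin n) (Fin n) ℂ)) G
        (selfAdjoint.submodule ℝ (Matrix (Fin n) (Fin n) ℂ)))
      (Q : SliceParam (range fun g => conjBy α g K) F N),
      0 ∈ P.param.source ∧ 0 ∈ Q.param.source ∧ (∀ p, P.param p = s.groupParam p) ∧
      (∀ p, Q.param p = s.orbitCurve p.1 + p.2) ∧
      ∀ p ∈ P.param.source, ((s.q p.1).1, (0 : N)) ∈ Q.param.source := by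
  obtain ⟨P, hP0, hP⟩ := s.exists_groupParam
  obtain ⟨N, e, Q, hQ0, hQ, hQ1, hQ2⟩ := s.exists_orbitParam
  let r : G × selfAdjoint.submodule ℝ (Matrix (Fin n) (Fin n) ℂ) → F × N :=
    fun p => ((s.q p.1).1, 0)
  have hr : Continuous r := by fun_prop
  have hr0 : r 0 = 0 := by simp [r]
  let W := P.param.source ∩ r ⁻¹' Q.source
  have hW : IsOpen W := P.param.open_source.inter (Q.open_source.preimage hr)
  have hW0 : 0 ∈ W := ⟨hP0, by rw [mem_preimage, hr0]; exact hQ0⟩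
  have hPW : IsOpen (P.param '' W) := P.param.isOpen_image_of_subset_source hW inter_subset_left
  have hnhds : (Subtype.val : unitaryGroup (Fin n) ℂ → _) ⁻¹' (P.param '' W) ∈
      𝓝 (1 : unitaryGroup (Fin n) ℂ) :=
    (hPW.preimage continuous_subtype_val).mem_nhds
      ⟨0, hW0, by rw [hP, s.groupParam_zero]; rfl⟩
  -- The projection is open and the orbit map an embedding, so there is a neighbourhood `V` of `K`
  -- in `B` such that every orbit point in `V` is `g · K` for some `g` in the image of `W` under
  -- `P`.
  have hmk := (QuotientGroup.isOpenMap_coe (N := H)).image_mem_nhds hnhds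
  rw [(isEmbedding_orbitMap hH).nhds_eq_comap, Filter.mem_comap] at hmk
  obtain ⟨V, hV, hVsub⟩ := hmk
  have hK : orbitMap hH ((1 : unitaryGroup (Fin n) ℂ) : unitaryGroup (Fin n) ℂ ⧸ H) = K :=
    conjBy_one α K
  rw [hK] at hV
  have hQcont : Continuous Q := by
    have h : (Q : F × N → B) = fun p => s.orbitCurve p.1 + p.2 := funext hQ
    rw [h]
    have := s.contDiff_orbitCurve.continuous
    fun_prop
  let W' : Set (F × N) := Q ⁻¹' interior V
  have hW' : IsOpen W' := isOpen_interior.preimage hQcont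
  let Q' : SliceParam (range fun g => conjBy α g K) F N :=
    { param := Q.restrOpen W' hW'
      contDiffOn_param := hQ1.mono inter_subset_left
      contDiffOn_symm := hQ2.mono inter_subset_left
      param_mem_iff := by
        intro p hp
        change Q p ∈ _ ↔ _
        constructor
        -- Such a point equals `orbitCurve x` with `x` the first coordinate of `g`; injectivity of
        -- `Q` on its source then gives `p = (x, 0)`.
        · intro hS
          rw [← range_orbitMap hH] at hS
          obtain ⟨x, hx⟩ := hS
          have hxV : x ∈ orbitMap hH ⁻¹' V := by
            rw [mem_preimage, hx]
            exact interior_subset hp.2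
          obtain ⟨g, ⟨z, hzW, hz⟩, rfl⟩ := hVsub hxV
          have hz2 : z.2 = 0 := (P.param_mem_iff z hzW.1).1 (by rw [hz]; exact g.2)
          have hg : g = s.expA (s.q z.1).1 * s.expB (s.q z.1).2 := by
            refine Subtype.ext ?_
            rw [← hz, hP, ← s.groupParam_zero_right, ← hz2]
          rw [orbitMap_mk, hg, conjBy_expA_mul_expB] at hx
          have hQr : Q (r z) = Q p := by
            rw [← hx, hQ]
            simp [r]
          rw [← Q.injOn hzW.2 hp.1 hQr]
        · intro hp2
          rw [hQ, hp2]
          exact ⟨s.expA p.1, by simp [conjBy_expA]⟩ }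
  -- `P` is shrunk so that the projection maps its domain into that of `Q'`.
  refine ⟨N, e, P.restrict (r ⁻¹' Q'.param.source) (Q'.param.open_source.preimage hr), Q',
    ⟨hP0, ?_⟩, ⟨hQ0, ?_⟩, hP, hQ, fun p hp => hp.2⟩
  · rw [mem_preimage, hr0]
    refine ⟨hQ0, ?_⟩
    change Q 0 ∈ interior V
    rw [hQ]
    simpa [orbitCurve_zero, mem_interior_iff_mem_nhds] using hV
  · change Q 0 ∈ interior V
    rw [hQ]
    simpa [orbitCurve_zero, mem_interior_iff_mem_nhds] using hV

end Splitting

end Twistor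

namespace Twistor

open Set Topology NormedSpace Matrix

variable {n : ℕ}

/-! ### Smooth structures and the equivariant diffeomorphism -/

section Orbit

variable {B : Type*} [NormedRing B] [NormedAlgebra ℝ B] [FiniteDimensional ℝ B]
  {α : Matrix (Fin n) (Fin n) ℂ →ₐ[ℝ] B} {K : B} {H : Subgroup (unitaryGroup (Fin n) ℂ)}

/-- The orbit of `K` under conjugation by `U(n)` is an embedded submanifold diffeomorphic to the
quotient of `U(n)` by the stabilizer of `K`. -/
theorem exists_smooth_structures
    (hH : ∀ g : unitaryGroup (Fin n) ℂ, g ∈ H ↔ Commute (α g.1) K) {O : Set B}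
    (hO : O = range fun g => conjBy α g K) :
    ∃ (c d : ℕ)
      (_ : ChartedSpace (EuclideanSpace ℝ (Fin c)) (unitaryGroup (Fin n) ℂ))
      (_ : ChartedSpace (EuclideanSpace ℝ (Fin d)) (unitaryGroup (Fin n) ℂ ⧸ H))
      (_ : ChartedSpace (EuclideanSpace ℝ (Fin d)) O),
      IsEmbeddedSubmanifold c
        (Subtype.val : unitaryGroup (Fin n) ℂ → Matrix (Fin n) (Fin n) ℂ) ∧
      IsQuotientManifold c H d ∧
      IsEmbeddedSubmanifold d (Subtype.val : O → B) ∧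
      ∃ Φ : (unitaryGroup (Fin n) ℂ ⧸ H) ≃ₘ⟮𝓡 d, 𝓡 d⟯ O,
        ∀ g : unitaryGroup (Fin n) ℂ, (Φ (QuotientGroup.mk g) : B) = conjBy α g K := by
  subst hO
  obtain ⟨c, d, d', ⟨s⟩⟩ := exists_splitting α K
  obtain ⟨N, e, P, Q, hP0, hQ0, hP, hQ, hPQ⟩ := s.exists_params hH
  let AU : SliceAtlas (unitaryGroup (Fin n) ℂ : Set (Matrix (Fin n) (Fin n) ℂ))
      (unitaryGroup (Fin n) ℂ) (EuclideanSpace ℝ (Fin c))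
      (selfAdjoint.submodule ℝ (Matrix (Fin n) (Fin n) ℂ)) :=
    P.sliceAtlas s.L leftMulCLE leftMulCLE_mem_iff fun y hy =>
      ⟨⟨y, hy⟩, 1, by
        have h := P.param.map_source hP0
        rwa [hP, s.groupParam_zero] at h, mul_one y⟩
  let AO : SliceAtlas (range fun g => conjBy α g K) (unitaryGroup (Fin n) ℂ)
      (EuclideanSpace ℝ (Fin d)) N :=
    Q.sliceAtlas e (conjCLE α) (conjBy_mem_range_iff α K) fun y hy => by
      obtain ⟨g, rfl⟩ := hy
      refine ⟨g, K, ?_, rfl⟩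
      have h := Q.param.map_source hQ0
      rw [hQ] at h
      simpa [s.orbitCurve_zero] using h
  have hU : IsEmbedding (Subtype.val : unitaryGroup (Fin n) ℂ → Matrix (Fin n) (Fin n) ℂ) :=
    IsEmbedding.subtypeVal
  have hUr : range (Subtype.val : unitaryGroup (Fin n) ℂ → Matrix (Fin n) (Fin n) ℂ) =
    unitaryGroup (Fin n) ℂ := Subtype.range_coe
  have hE := isEmbedding_orbitMap hH
  have hEr := range_orbitMap hH
  have hO : IsEmbedding (Subtype.val : (range fun g => conjBy α g K) → B) := IsEmbedding.subtypeVal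
  have hOr : range (Subtype.val : (range fun g => conjBy α g K) → B) =
    range fun g => conjBy α g K := Subtype.range_coe
  have : Nonempty (range fun g => conjBy α g K) := ⟨⟨_, mem_range_self 1⟩⟩
  let cU := AU.chartedSpace hU hUr
  -- Quotient and orbit receive the same slice atlas, through the orbit map and through the
  -- inclusion.
  let cE := AO.chartedSpace hE hEr
  let cO := AO.chartedSpace hO hOr
  have mU : IsManifold (𝓡 c) ∞ (unitaryGroup (Fin n) ℂ) := AU.isManifold hU hUr
  have mE : IsManifold (𝓡 d) ∞ (unitaryGroup (Fin n) ℂ ⧸ H) := AO.isManifold hE hEr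
  have mO : IsManifold (𝓡 d) ∞ (range fun g => conjBy α g K) := AO.isManifold hO hOr
  have eE : Manifold.IsSmoothEmbedding (𝓡 d) 𝓘(ℝ, B) ∞ (orbitMap hH) :=
    AO.isSmoothEmbedding hE hEr
  have eO : Manifold.IsSmoothEmbedding (𝓡 d) 𝓘(ℝ, B) ∞
    (Subtype.val : (range fun g => conjBy α g K) → B) := AO.isSmoothEmbedding hO hOr
  refine ⟨c, d, cU, cE, cO, ⟨mU, AU.isSmoothEmbedding hU hUr⟩, ⟨mE, ?_⟩, ⟨mO, eO⟩, ?_⟩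
  · refine Manifold.IsSubmersionOfComplement.isSubmersion (F := EuclideanSpace ℝ (Fin d'))
      fun g => ?_
    -- In the charts translated by the same `g`, the projection keeps `(q z).1` and forgets `(q
    -- z).2`.
    have key : ∀ z : EuclideanSpace ℝ (Fin c), (z, 0) ∈ P.param.source →
        ∀ h : unitaryGroup (Fin n) ℂ, h.1 = AU.param g (z, 0) →
        orbitMap hH h = AO.param g ((s.q z).1, 0) := by
      intro z hz h hh
      have h1 : h.1 = (g * (s.expA (s.q z).1 * s.expB (s.q z).2)).1 := by
        rw [hh]
        change g.1 * P.param (z, 0) = _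
        rw [hP, s.groupParam_zero_right]
        rfl
      rw [Subtype.ext h1, orbitMap_mk, conjBy_mul, s.conjBy_expA_mul_expB]
      change _ = conjBy α g (Q.param ((s.q z).1, 0))
      rw [hQ]
      simp
    have hsrc : (AU.chart hU hUr g).source ⊆
        (QuotientGroup.mk : _ → unitaryGroup (Fin n) ℂ ⧸ H) ⁻¹' (AO.chart hE hEr g).source := by
      intro h hh
      have hz := (AU.chart hU hUr g).map_source hh
      have h1 := AU.incl_chart_symm hU hUr hz
      rw [(AU.chart hU hUr g).left_inv hh] at h1
      change orbitMap hH h ∈ (AO.param g).target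
      rw [key _ hz h h1]
      exact (AO.param g).map_source (hPQ (AU.chart hU hUr g h, 0) hz)
    have hg : g ∈ (AU.chart hU hUr g).source := by
      have h1 : AU.param g 0 = g.1 := by
        change g.1 * P.param 0 = _
        rw [hP, s.groupParam_zero, mul_one]
      have h2 := (AU.param g).map_source (show 0 ∈ (AU.param g).source from hP0)
      rw [h1] at h2
      exact h2
    refine Manifold.IsSubmersionAtOfComplement.mk_of_charts s.q (AU.chart hU hUr g)
      (AO.chart hE hEr g) hg (hsrc hg) (AU.chart_mem_maximalAtlas hU hUr g)
      (AO.chart_mem_maximalAtlas hE hEr g) hsrc ?_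
    intro z hz
    have hz' : z ∈ (AU.chart hU hUr g).target := by simpa using hz
    have h1 := key z hz' _ (AU.incl_chart_symm hU hUr hz')
    change ((AO.param g).symm (orbitMap hH ((AU.chart hU hUr g).symm z :
      unitaryGroup (Fin n) ℂ))).1 = (s.q z).1
    rw [h1, (AO.param g).left_inv (hPQ _ hz')]
  · let Φ : (unitaryGroup (Fin n) ℂ ⧸ H) ≃ₜ (range fun g => conjBy α g K) :=
      hE.toHomeomorph.trans (Homeomorph.setCongr hEr)
    have hΦ : Subtype.val ∘ Φ = orbitMap hH := rfl
    have hΦ' : orbitMap hH ∘ Φ.symm = Subtype.val := by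
      rw [← hΦ, Function.comp_assoc, Φ.self_comp_symm, Function.comp_id]
    refine ⟨{ Φ.toEquiv with
      contMDiff_toFun := ?_
      contMDiff_invFun := ?_ }, fun g => rfl⟩
    -- A continuous map is smooth once its composite with an immersion is. For `Φ` the composite is
    -- the orbit map; for its inverse it is the inclusion of the orbit.
    · exact (ContMDiff.iff_comp_isImmersion eO.isImmersion).2 ⟨Φ.continuous, hΦ ▸ eE.contMDiff⟩
    · refine (ContMDiff.iff_comp_isImmersion eE.isImmersion).2 ⟨Φ.symm.continuous, ?_⟩
      exact (congrArg (ContMDiff (𝓡 d) 𝓘(ℝ, B) ∞) hΦ').mpr eO.contMDiff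

end Orbit

end Twistor

/-! ### Unitary and quaternionic frames -/

namespace Twistor

open Module

variable {V : Type*} [NormedAddCommGroup V] [InnerProductSpace ℝ V]

theorem inner_self_apply_of_skew {J : V →L[ℝ] V}
    (hJ : ∀ x y, ⟪J x, y⟫_ℝ = -⟪x, J y⟫_ℝ) (x : V) :
    ⟪x, J x⟫_ℝ = 0 := by
  have := hJ x x
  rw [real_inner_comm] at this
  linarith

section Frames

variable [FiniteDimensional ℝ V]

/-- Suppose that the operators `T i` preserve the subspace `W`, map each of its vectors to an
orthogonal family of vectors of the same length, and preserve orthogonality to such families. Then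
`W` contains orthonormal families of the form `T i (u a)`, of any size its dimension allows. -/
theorem exists_orthonormal_orbits (W : Submodule ℝ V) {r : ℕ} (hr : 0 < r)
    (T : Fin r → V →L[ℝ] V) (hW : ∀ i, ∀ x ∈ W, T i x ∈ W)
    (hT : ∀ u ∈ W, ∀ i j, ⟪T i u, T j u⟫_ℝ = if i = j then ⟪u, u⟫_ℝ else 0)
    (hperp : ∀ u ∈ W, ∀ w ∈ W, (∀ j, ⟪T j u, w⟫_ℝ = 0) → ∀ i j, ⟪T j u, T i w⟫_ℝ = 0)
    (k : ℕ) (hk : r * k ≤ finrank ℝ W) :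
    ∃ u : Fin k → V, (∀ a, u a ∈ W) ∧ Orthonormal ℝ fun p : Fin k × Fin r => T p.2 (u p.1) := by
  induction k with
  | zero => exact ⟨Fin.elim0, fun a => a.elim0, ⟨fun p => p.1.elim0, fun p => p.1.elim0⟩⟩
  | succ k ih =>
    obtain ⟨u, huW, hu⟩ := ih (le_trans (Nat.mul_le_mul_left r k.le_succ) hk)
    let X := Submodule.span ℝ (Set.range fun p : Fin k × Fin r => T p.2 (u p.1))
    have hXW : X ≤ W := by
      rw [Submodule.span_le]
      rintro _ ⟨p, rfl⟩
      exact hW _ _ (huW _)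
    have hX : finrank ℝ X ≤ k * r := by
      have := finrank_range_le_card (R := ℝ) fun p : Fin k × Fin r => T p.2 (u p.1)
      simpa [Set.finrank, X] using this
    have hfin := Submodule.finrank_add_inf_finrank_orthogonal hXW
    -- `X` is spanned by `k * r` vectors and `W` has dimension at least `k * r + r`, so there is
    -- room for another vector.
    have hpos : 0 < finrank ℝ (Xᗮ ⊓ W : Submodule ℝ V) := by
      have : r * (k + 1) = k * r + r := by ring
      omega
    have := finrank_pos_iff.1 hpos
    obtain ⟨⟨w₀, hw₀⟩, hne⟩ := exists_ne (0 : (Xᗮ ⊓ W : Submodule ℝ V))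
    have hw₀0 : w₀ ≠ 0 := fun h => hne (Subtype.ext h)
    let w := (‖w₀‖⁻¹ : ℝ) • w₀
    have hw : w ∈ Xᗮ ⊓ W := Submodule.smul_mem _ _ hw₀
    have hw1 : ⟪w, w⟫_ℝ = 1 := by
      rw [real_inner_self_eq_norm_sq, norm_smul, norm_inv, norm_norm,
        inv_mul_cancel₀ (norm_ne_zero_iff.2 hw₀0), one_pow]
    have hwX : ∀ a j, ⟪T j (u a), w⟫_ℝ = 0 := fun a j =>
      hw.1 _ (Submodule.subset_span ⟨(a, j), rfl⟩)
    have hwT : ∀ a i j, ⟪T j (u a), T i w⟫_ℝ = 0 := fun a =>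
      hperp _ (huW a) w hw.2 (hwX a)
    rw [orthonormal_iff_ite] at hu
    refine ⟨Fin.snoc u w, Fin.lastCases (by simpa using hw.2) (by simpa using huW), ?_⟩
    rw [orthonormal_iff_ite]
    rintro ⟨a, i⟩ ⟨b, j⟩
    induction a using Fin.lastCases with
    | last =>
      induction b using Fin.lastCases with
      | last => simp [hT w hw.2, hw1, -inner_self_eq_norm_sq_to_K]
      | cast b =>
        have : Fin.last k ≠ b.castSucc := (Fin.castSucc_lt_last b).ne'
        simp [this, real_inner_comm _ (T i w), hwT]
    | cast a =>
      induction b using Fin.lastCases with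
      | last =>
        have : a.castSucc ≠ Fin.last k := (Fin.castSucc_lt_last a).ne
        simp [this, hwT]
      | cast b => simpa using hu (a, i) (b, j)

/-- A family of vectors which is unitary for the complex structure `J`. -/
def IsUnitaryFrame (J : V →L[ℝ] V) {ι : Type*} (u : ι → V) : Prop :=
  Orthonormal ℝ u ∧ ∀ a b, ⟪u a, J (u b)⟫_ℝ = 0

variable {J I : V →L[ℝ] V} {W : Submodule ℝ V}

theorem exists_unitaryFrame (hJ : ∀ x y, ⟪J x, y⟫_ℝ = -⟪x, J y⟫_ℝ) (hJW : ∀ x ∈ W, J x ∈ W)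
    (hJJ : ∀ x ∈ W, J (J x) = -x) (m : ℕ) (hm : finrank ℝ W = 2 * m) :
    ∃ u : Fin m → V, (∀ a, u a ∈ W) ∧ IsUnitaryFrame J u := by
  obtain ⟨u, huW, hu⟩ := exists_orthonormal_orbits W two_pos ![1, J]
    (by simpa [Fin.forall_fin_two] using fun x hx => hJW x hx)
    (fun u hu => by
      have h0 := inner_self_apply_of_skew hJ u
      have h1 : ⟪J u, u⟫_ℝ = 0 := by rw [hJ, h0, neg_zero]
      have h2 : ⟪J u, J u⟫_ℝ = ⟪u, u⟫_ℝ := by rw [hJ, hJJ u hu, inner_neg_right, neg_neg]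
      simp [Fin.forall_fin_two, h0, h1, h2, -inner_self_eq_norm_sq_to_K])
    (fun u hu w hw h => by
      simp only [Fin.forall_fin_two, Matrix.cons_val_zero, Matrix.cons_val_one,
        one_apply_eq_self] at h ⊢
      have h0 : ⟪u, J w⟫_ℝ = 0 := by rw [← neg_eq_zero, ← hJ, h.2]
      have h1 : ⟪J u, J w⟫_ℝ = 0 := by rw [hJ, hJJ w hw, inner_neg_right, neg_neg, h.1]
      exact ⟨h, h0, h1⟩) m hm.ge
  rw [orthonormal_iff_ite] at hu
  refine ⟨u, huW, orthonormal_iff_ite.2 fun a b => ?_, fun a b => ?_⟩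
  · simpa using hu (a, 0) (b, 0)
  · simpa using hu (a, 0) (b, 1)

/-- The operators `1, J, I, JI` send a vector to four orthogonal vectors of equal length, spanning a
quaternionic line. For the complex structure `J` that line has the unitary basis `u, I u`. -/
theorem exists_quaternionicFrame (hJ : ∀ x y, ⟪J x, y⟫_ℝ = -⟪x, J y⟫_ℝ)
    (hI : ∀ x y, ⟪I x, y⟫_ℝ = -⟪x, I y⟫_ℝ) (hJW : ∀ x ∈ W, J x ∈ W) (hIW : ∀ x ∈ W, I x ∈ W)
    (hJJ : ∀ x ∈ W, J (J x) = -x) (hII : ∀ x ∈ W, I (I x) = -x)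
    (hIJ : ∀ x ∈ W, I (J x) = -J (I x)) (k : ℕ) (hk : finrank ℝ W = 4 * k) :
    ∃ u : Fin k ⊕ Fin k → V, (∀ a, u a ∈ W) ∧ IsUnitaryFrame J u ∧
      (∀ j, I (u (Sum.inl j)) = u (Sum.inr j)) ∧ ∀ j, I (u (Sum.inr j)) = -u (Sum.inl j) := by
  have hJ' : ∀ x y, ⟪x, J y⟫_ℝ = -⟪J x, y⟫_ℝ := fun x y => by rw [hJ, neg_neg]
  have hI' : ∀ x y, ⟪x, I y⟫_ℝ = -⟪I x, y⟫_ℝ := fun x y => by rw [hI, neg_neg]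
  have hJ2 : ∀ x ∈ W, ∀ y, ⟪J x, J y⟫_ℝ = ⟪x, y⟫_ℝ := fun x hx y => by
    rw [hJ', hJJ x hx, inner_neg_left, neg_neg]
  have hI2 : ∀ x ∈ W, ∀ y, ⟪I x, I y⟫_ℝ = ⟪x, y⟫_ℝ := fun x hx y => by
    rw [hI', hII x hx, inner_neg_left, neg_neg]
  obtain ⟨u, huW, hu⟩ := exists_orthonormal_orbits W (r := 4) (by norm_num) ![1, J, I, J ∘L I]
    (by
      intro i x hx
      fin_cases i
      exacts [hx, hJW x hx, hIW x hx, hJW _ (hIW x hx)])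
    (fun u hu => by
      have h01 := inner_self_apply_of_skew hJ u
      have h02 := inner_self_apply_of_skew hI u
      -- A product of anticommuting skew operators is skew.
      have h03 : ⟪u, J (I u)⟫_ℝ = 0 := by
        have h1 := hJ' u (I u)
        have h2 := hI' (J u) u
        rw [hIJ u hu, inner_neg_left, neg_neg] at h2
        linarith [real_inner_comm (J u) (I u), real_inner_comm u (J (I u))]
      have h12 : ⟪J u, I u⟫_ℝ = 0 := by rw [hJ, h03, neg_zero]
      have h13 : ⟪J u, J (I u)⟫_ℝ = 0 := by rw [hJ2 u hu, h02]
      have h23 := inner_self_apply_of_skew hJ (I u)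
      have h33 : ⟪J (I u), J (I u)⟫_ℝ = ⟪u, u⟫_ℝ := by rw [hJ2 _ (hIW u hu), hI2 u hu]
      intro i j
      fin_cases i <;> fin_cases j <;>
        simp [h01, h02, h03, h12, h13, h23, h33, hJ2 u hu, hI2 u hu, real_inner_comm u,
          real_inner_comm (J u) (I u), real_inner_comm (J u) (J (I u)),
          real_inner_comm (I u) (J (I u)), -inner_self_eq_norm_sq_to_K])
    (fun u hu w hw h => by
      have hJperp : ∀ w, (∀ j, ⟪(![1, J, I, J ∘L I] : Fin 4 → V →L[ℝ] V) j u, w⟫_ℝ = 0) →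
          ∀ j, ⟪(![1, J, I, J ∘L I] : Fin 4 → V →L[ℝ] V) j u, J w⟫_ℝ = 0 := by
        intro w h
        have h0 : ⟪u, w⟫_ℝ = 0 := h 0
        have h1 : ⟪J u, w⟫_ℝ = 0 := h 1
        have h2 : ⟪I u, w⟫_ℝ = 0 := h 2
        have h3 : ⟪J (I u), w⟫_ℝ = 0 := h 3
        intro j
        fin_cases j
        · simpa [hJ'] using h1
        · simpa [hJ2 u hu] using h0
        · simpa [hJ'] using h3
        · simpa [hJ2 _ (hIW u hu)] using h2
      have hIperp : ∀ w, (∀ j, ⟪(![1, J, I, J ∘L I] : Fin 4 → V →L[ℝ] V) j u, w⟫_ℝ = 0) →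
          ∀ j, ⟪(![1, J, I, J ∘L I] : Fin 4 → V →L[ℝ] V) j u, I w⟫_ℝ = 0 := by
        intro w h
        have h0 : ⟪u, w⟫_ℝ = 0 := h 0
        have h1 : ⟪J u, w⟫_ℝ = 0 := h 1
        have h2 : ⟪I u, w⟫_ℝ = 0 := h 2
        have h3 : ⟪J (I u), w⟫_ℝ = 0 := h 3
        intro j
        fin_cases j
        · simpa [hI'] using h2
        · simpa [hI' _ w, hIJ u hu] using h3
        · simpa [hI2 u hu] using h0
        · simpa [hI' _ w, hIJ _ (hIW u hu), hII u hu] using h1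
      intro i
      fin_cases i
      exacts [h, hJperp w h, hIperp w h, hJperp _ (hIperp w h)])
    k hk.ge
  rw [orthonormal_iff_ite] at hu
  refine ⟨Sum.elim u fun j => I (u j), ?_, ⟨orthonormal_iff_ite.2 ?_, ?_⟩, fun j => rfl,
    fun j => hII _ (huW j)⟩
  · rintro (a | a)
    exacts [huW a, hIW _ (huW a)]
  · rintro (a | a) (b | b)
    · simpa using hu (a, 0) (b, 0)
    · simpa using hu (a, 0) (b, 2)
    · simpa using hu (a, 2) (b, 0)
    · simpa using hu (a, 2) (b, 2)
  · rintro (a | a) (b | b)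
    · simpa using hu (a, 0) (b, 1)
    · simpa using hu (a, 0) (b, 3)
    · simpa using hu (a, 2) (b, 1)
    · simpa using hu (a, 2) (b, 3)

end Frames

/-! ### The eigenspaces of `JK + KJ` -/

section Eigenspaces

variable {J K : V →L[ℝ] V}

theorem apply_apply_of_mem_twistorSpace (hJ : J ∈ twistorSpace V) (x : V) : J (J x) = -x :=
  DFunLike.congr_fun hJ.1 x

theorem inner_apply_of_mem_twistorSpace (hJ : J ∈ twistorSpace V) (x y : V) :
    ⟪J x, y⟫_ℝ = -⟪x, J y⟫_ℝ := by
  rw [← hJ.2 x (J y), apply_apply_of_mem_twistorSpace hJ, inner_neg_right, neg_neg]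

theorem mem_eigenspace_iff {ε : ℝ} {x : V} :
    x ∈ eigenspace J K ε ↔ J (K x) + K (J x) = (2 * ε) • x := by
  simp [eigenspace, sub_eq_zero]

theorem apply_left_mem_eigenspace (hJ : J ∈ twistorSpace V) {ε : ℝ} {x : V}
    (hx : x ∈ eigenspace J K ε) :
    J x ∈ eigenspace J K ε := by
  rw [mem_eigenspace_iff] at hx ⊢
  rw [← map_smul, ← hx, map_add, apply_apply_of_mem_twistorSpace hJ,
    apply_apply_of_mem_twistorSpace hJ, map_neg, add_comm]

theorem apply_right_mem_eigenspace (hK : K ∈ twistorSpace V) {ε : ℝ} {x : V}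
    (hx : x ∈ eigenspace J K ε) :
    K x ∈ eigenspace J K ε := by
  rw [mem_eigenspace_iff] at hx ⊢
  rw [← map_smul, ← hx, map_add, apply_apply_of_mem_twistorSpace hK,
    apply_apply_of_mem_twistorSpace hK, map_neg, add_comm]

/-- `JK + KJ` is self-adjoint, because `JK` and `KJ` are adjoint to each other. -/
theorem inner_eq_zero_of_mem_eigenspace (hJ : J ∈ twistorSpace V) (hK : K ∈ twistorSpace V)
    {ε δ : ℝ} (h : ε ≠ δ) {x y : V}
    (hx : x ∈ eigenspace J K ε) (hy : y ∈ eigenspace J K δ) : ⟪x, y⟫_ℝ = 0 := by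
  rw [mem_eigenspace_iff] at hx hy
  have h1 : (2 * ε) * ⟪x, y⟫_ℝ = (2 * δ) * ⟪x, y⟫_ℝ := by
    rw [← real_inner_smul_left, ← real_inner_smul_right, ← hx, ← hy, inner_add_left,
      inner_add_right, inner_apply_of_mem_twistorSpace hJ, inner_apply_of_mem_twistorSpace hK,
      inner_apply_of_mem_twistorSpace hK, inner_apply_of_mem_twistorSpace hJ]
    ring
  have h2 : (ε - δ) * ⟪x, y⟫_ℝ = 0 := by linarith
  exact (mul_eq_zero.1 h2).resolve_left (sub_ne_zero.2 h)

/-- Equality case of Cauchy–Schwarz: `⟪K x, J x⟫ = -ε ‖x‖²`, whence `‖K x + ε J x‖² = (1 - ε²) ‖x‖²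
= 0`. -/
theorem apply_eq_neg_smul_of_mem_eigenspace (hJ : J ∈ twistorSpace V) (hK : K ∈ twistorSpace V)
    {ε : ℝ} (hε : ε ^ 2 = 1) {x : V}
    (hx : x ∈ eigenspace J K ε) : K x = -(ε • J x) := by
  rw [mem_eigenspace_iff] at hx
  have h1 : ⟪J (K x) + K (J x), x⟫_ℝ = (2 * ε) * ⟪x, x⟫_ℝ := by rw [hx, real_inner_smul_left]
  rw [inner_add_left, inner_apply_of_mem_twistorSpace hJ (K x),
    inner_apply_of_mem_twistorSpace hK (J x), real_inner_comm (K x) (J x)] at h1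
  have h2 : ⟪K x + ε • J x, K x + ε • J x⟫_ℝ = 0 := by
    rw [inner_add_add_self, real_inner_smul_left, real_inner_smul_right, real_inner_smul_left,
      real_inner_smul_right, hK.2, hJ.2, real_inner_comm (K x) (J x)]
    linear_combination (-ε) * h1 + (-⟪x, x⟫_ℝ) * hε
  exact eq_neg_of_add_eq_zero_left (inner_self_eq_zero.1 h2)

end Eigenspaces

end Twistor

namespace Twistor

open Module Matrix

variable {V : Type*} [NormedAddCommGroup V] [InnerProductSpace ℝ V] {n : ℕ}

/-! ### Complex coordinates: `V = ℂⁿ` and `U(J) = U(n)` -/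

section FrameMap

variable (J : V →L[ℝ] V) (u : Fin n → V)

/-- The map `z ↦ ∑ z_a u_a`, where `i` acts on `V` as `J`. -/
noncomputable def frameMap : (Fin n → ℂ) →ₗ[ℝ] V where
  toFun z := ∑ a, ((z a).re • u a + (z a).im • J (u a))
  map_add' z w := by
    rw [← Finset.sum_add_distrib]
    refine Finset.sum_congr rfl fun a _ => ?_
    simp only [Pi.add_apply, Complex.add_re, Complex.add_im]
    module
  map_smul' c z := by
    rw [RingHom.id_apply, Finset.smul_sum]
    refine Finset.sum_congr rfl fun a _ => ?_
    simp only [Pi.smul_apply, Complex.smul_re, Complex.smul_im, smul_eq_mul]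
    module

theorem frameMap_apply (z : Fin n → ℂ) :
    frameMap J u z = ∑ a, ((z a).re • u a + (z a).im • J (u a)) := rfl

theorem frameMap_single (b : Fin n) : frameMap J u (Pi.single b 1) = u b := by
  rw [frameMap_apply, Finset.sum_eq_single b]
  · simp
  · intro a _ hab
    simp [Pi.single_eq_of_ne hab]
  · simp

variable {J u} (hJ : J ∈ twistorSpace V) (hu : IsUnitaryFrame J u)

theorem apply_frameMap (hJ : J ∈ twistorSpace V) (z : Fin n → ℂ) :
    J (frameMap J u z) = frameMap J u (Complex.I • z) := by
  rw [frameMap_apply, frameMap_apply, map_sum]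
  refine Finset.sum_congr rfl fun a _ => ?_
  rw [map_add, map_smul, map_smul, apply_apply_of_mem_twistorSpace hJ]
  simp only [Pi.smul_apply, smul_eq_mul, Complex.mul_re, Complex.mul_im, Complex.I_re, Complex.I_im]
  module

theorem inner_frameMap (hJ : J ∈ twistorSpace V) (hu : IsUnitaryFrame J u) (z w : Fin n → ℂ) :
    ⟪frameMap J u z, frameMap J u w⟫_ℝ = (star z ⬝ᵥ w).re := by
  have h1 := orthonormal_iff_ite.1 hu.1
  have h2 : ∀ a b, ⟪J (u a), u b⟫_ℝ = 0 := fun a b => by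
    rw [inner_apply_of_mem_twistorSpace hJ, hu.2, neg_zero]
  simp only [frameMap_apply, sum_inner, inner_sum, inner_add_left, inner_add_right,
    real_inner_smul_left, real_inner_smul_right, hJ.2, h1, h2, hu.2]
  simp [dotProduct, Complex.mul_re, mul_comm]

open scoped ComplexOrder in
theorem frameMap_injective (hJ : J ∈ twistorSpace V) (hu : IsUnitaryFrame J u) :
    Function.Injective (frameMap J u) := by
  rw [injective_iff_map_eq_zero]
  intro z hz
  have h := inner_frameMap hJ hu z z
  rw [hz, inner_zero_left] at h
  have h0 : star z ⬝ᵥ z = 0 := by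
    refine Complex.ext h.symm ?_
    simp [dotProduct, Complex.mul_im, mul_comm]
  exact dotProduct_star_self_eq_zero.1 h0

variable [FiniteDimensional ℝ V] (hn : finrank ℝ V = 2 * n)

/-- The linear coordinates given by a unitary frame with `n` elements. -/
noncomputable def frameEquiv : (Fin n → ℂ) ≃ₗ[ℝ] V :=
  LinearEquiv.ofInjectiveOfFinrankEq (frameMap J u) (frameMap_injective hJ hu) (by
    rw [hn, finrank_pi_fintype]
    simp [Complex.finrank_real_complex, mul_comm])

theorem frameEquiv_apply (z : Fin n → ℂ) : frameEquiv hJ hu hn z = frameMap J u z := rfl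

/-- Matrices as endomorphisms of `V`, by means of a unitary frame. -/
noncomputable def matrixHom : Matrix (Fin n) (Fin n) ℂ →ₐ[ℝ] (V →L[ℝ] V) :=
  AlgHom.ofLinearMap
    { toFun := fun A => LinearMap.toContinuousLinearMap ((frameEquiv hJ hu hn).toLinearMap ∘ₗ
        A.mulVecLin.restrictScalars ℝ ∘ₗ (frameEquiv hJ hu hn).symm.toLinearMap)
      map_add' := fun A B => by
        ext x
        simp
      map_smul' := fun c A => by
        ext x
        simp }
    (by
      ext x
      simp)
    (fun A B => by
      ext x
      simp [mulVec_mulVec])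

theorem matrixHom_frameMap (A : Matrix (Fin n) (Fin n) ℂ) (z : Fin n → ℂ) :
    matrixHom hJ hu hn A (frameMap J u z) = frameMap J u (A *ᵥ z) := by
  rw [← frameEquiv_apply hJ hu hn, ← frameEquiv_apply hJ hu hn]
  simp [matrixHom]

theorem frameMap_surjective (hJ : J ∈ twistorSpace V) (hu : IsUnitaryFrame J u)
    (hn : finrank ℝ V = 2 * n) : Function.Surjective (frameMap J u) :=
  (frameEquiv hJ hu hn).surjective

theorem matrixHom_injective : Function.Injective (matrixHom hJ hu hn) := by
  intro A B hAB
  refine Matrix.ext_of_mulVec_single fun b => frameMap_injective hJ hu ?_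
  rw [← matrixHom_frameMap hJ hu hn, hAB, matrixHom_frameMap]

theorem commute_matrixHom (A : Matrix (Fin n) (Fin n) ℂ) : Commute (matrixHom hJ hu hn A) J := by
  refine ContinuousLinearMap.ext fun x => ?_
  obtain ⟨z, rfl⟩ := frameMap_surjective hJ hu hn x
  simp only [mul_apply_eq_comp]
  rw [apply_frameMap hJ, matrixHom_frameMap, matrixHom_frameMap, apply_frameMap hJ, mulVec_smul]

theorem inner_matrixHom {A : Matrix (Fin n) (Fin n) ℂ} (hA : A ∈ unitaryGroup (Fin n) ℂ) (x y : V) :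
    ⟪matrixHom hJ hu hn A x, matrixHom hJ hu hn A y⟫_ℝ = ⟪x, y⟫_ℝ := by
  obtain ⟨z, rfl⟩ := frameMap_surjective hJ hu hn x
  obtain ⟨w, rfl⟩ := frameMap_surjective hJ hu hn y
  rw [matrixHom_frameMap, matrixHom_frameMap, inner_frameMap hJ hu, inner_frameMap hJ hu,
    star_mulVec, ← dotProduct_mulVec, mulVec_mulVec, ← star_eq_conjTranspose,
    mem_unitaryGroup_iff'.1 hA, one_mulVec]

/-- Commuting with `J` is complex linearity, so `T` is determined by its values on the frame, which
give the columns. -/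
theorem exists_matrixHom_eq {T : V →L[ℝ] V} (hTJ : T * J = J * T) :
    ∃ A, matrixHom hJ hu hn A = T := by
  refine ⟨Matrix.of fun a b => (frameEquiv hJ hu hn).symm (T (u b)) a, ?_⟩
  set A : Matrix (Fin n) (Fin n) ℂ := Matrix.of fun a b => (frameEquiv hJ hu hn).symm (T (u b)) a
  have hb : ∀ b, matrixHom hJ hu hn A (u b) = T (u b) := fun b => by
    rw [← frameMap_single J u b, matrixHom_frameMap, mulVec_single_one, frameMap_single]
    have : A.col b = (frameEquiv hJ hu hn).symm (T (u b)) := rfl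
    rw [this, ← frameEquiv_apply hJ hu hn, LinearEquiv.apply_symm_apply]
  refine ContinuousLinearMap.ext fun x => ?_
  obtain ⟨z, rfl⟩ := frameMap_surjective hJ hu hn x
  have h1 : ∀ y, matrixHom hJ hu hn A (J y) = J (matrixHom hJ hu hn A y) := fun y =>
    DFunLike.congr_fun (commute_matrixHom hJ hu hn A) y
  have h2 : ∀ y, T (J y) = J (T y) := fun y => DFunLike.congr_fun hTJ y
  rw [frameMap_apply, map_sum, map_sum]
  refine Finset.sum_congr rfl fun a _ => ?_
  simp only [map_add, map_smul, h1, h2, hb]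

/-- The metric is only the real part of the Hermitian form; replacing `w` by `i w` recovers the
imaginary part. -/
theorem mem_unitaryGroup_of_inner_matrixHom {A : Matrix (Fin n) (Fin n) ℂ}
    (h : ∀ x y, ⟪matrixHom hJ hu hn A x, matrixHom hJ hu hn A y⟫_ℝ = ⟪x, y⟫_ℝ) :
    A ∈ unitaryGroup (Fin n) ℂ := by
  have hre : ∀ z w : Fin n → ℂ, (star z ⬝ᵥ ((star A * A) *ᵥ w)).re = (star z ⬝ᵥ w).re := by
    intro z w
    have := h (frameMap J u z) (frameMap J u w)
    rwa [matrixHom_frameMap, matrixHom_frameMap, inner_frameMap hJ hu, inner_frameMap hJ hu,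
      star_mulVec, ← dotProduct_mulVec, mulVec_mulVec, ← star_eq_conjTranspose] at this
  have him : ∀ z w : Fin n → ℂ, star z ⬝ᵥ ((star A * A) *ᵥ w) = star z ⬝ᵥ w := by
    intro z w
    refine Complex.ext (hre z w) ?_
    have := hre z (Complex.I • w)
    simpa [mulVec_smul, dotProduct_smul] using this
  rw [mem_unitaryGroup_iff']
  ext a b
  have := him (Pi.single a 1) (Pi.single b 1)
  refine Eq.trans (b := if b = a then 1 else 0) ?_ (by simp [Matrix.one_apply, eq_comm])
  simpa [Pi.star_single, ← Pi.single_star, Pi.single_apply] using this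

/-- The isomorphism of `U(n)` with `U(J)` given by a unitary frame. -/
noncomputable def unitaryHom : unitaryGroup (Fin n) ℂ →* unitaryOf J :=
  ((Units.map (matrixHom hJ hu hn : Matrix (Fin n) (Fin n) ℂ →* (V →L[ℝ] V))).comp
    Unitary.toUnits).codRestrict (unitaryOf J) fun g =>
      ⟨inner_matrixHom hJ hu hn g.2, commute_matrixHom hJ hu hn g.1⟩

theorem coe_unitaryHom (g : unitaryGroup (Fin n) ℂ) :
    ((unitaryHom hJ hu hn g : (V →L[ℝ] V)ˣ) : V →L[ℝ] V) = matrixHom hJ hu hn g.1 := rfl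

theorem unitaryHom_bijective : Function.Bijective (unitaryHom hJ hu hn) := by
  constructor
  · intro g h hgh
    refine Subtype.ext (matrixHom_injective hJ hu hn ?_)
    rw [← coe_unitaryHom, hgh, coe_unitaryHom]
  · rintro ⟨T, hT⟩
    obtain ⟨A, hA⟩ := exists_matrixHom_eq hJ hu hn hT.2
    have hAU : A ∈ unitaryGroup (Fin n) ℂ :=
      mem_unitaryGroup_of_inner_matrixHom hJ hu hn (by rw [hA]; exact hT.1)
    exact ⟨⟨A, hAU⟩, Subtype.ext (Units.ext hA)⟩

theorem continuous_unitaryHom : Continuous (unitaryHom hJ hu hn) := by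
  have hα : Continuous (matrixHom hJ hu hn) :=
    (matrixHom hJ hu hn).toLinearMap.continuous_of_finiteDimensional
  refine Continuous.subtype_mk (Units.continuous_iff.2 ⟨?_, ?_⟩) _
  · exact hα.comp continuous_subtype_val
  · exact hα.comp (continuous_subtype_val.comp continuous_inv)

/-- The isomorphism of topological groups `U(n) ≅ U(J)` given by a unitary frame. -/
noncomputable def unitaryEquiv : unitaryGroup (Fin n) ℂ ≃ₜ* unitaryOf J :=
  { MulEquiv.ofBijective _ (unitaryHom_bijective hJ hu hn) with
    continuous_toFun := continuous_unitaryHom hJ hu hn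
    continuous_invFun := (Continuous.homeoOfEquivCompactToT2
      (f := (MulEquiv.ofBijective _ (unitaryHom_bijective hJ hu hn)).toEquiv)
      (continuous_unitaryHom hJ hu hn)).symm.continuous }

theorem orbit_eq_range_conjBy (K : V →L[ℝ] V) :
    orbit J K = Set.range fun g => conjBy (matrixHom hJ hu hn) g K := by
  rw [orbit, ← (unitaryHom_bijective hJ hu hn).2.range_comp]
  rfl

end FrameMap

end Twistor

namespace Twistor

open Matrix

/-! ### Block diagonal matrices and the symplectic condition -/

section Blocks

variable {l : ℕ} {k : Fin l → ℕ} {m₁ m₂ : ℕ}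

/-- The entrywise complex conjugate of a matrix. -/
noncomputable def conjMatrix {ι : Type*} (A : Matrix ι ι ℂ) : Matrix ι ι ℂ := A.map (starRingEnd ℂ)

theorem conjMatrix_blockMatrix
    (A : ∀ i, Matrix (Fin (k i) ⊕ Fin (k i)) (Fin (k i) ⊕ Fin (k i)) ℂ)
    (B : Matrix (Fin m₁) (Fin m₁) ℂ) (C : Matrix (Fin m₂) (Fin m₂) ℂ) :
    conjMatrix (blockMatrix A B C) =
      blockMatrix (fun i => conjMatrix (A i)) (conjMatrix B) (conjMatrix C) := by
  simp [conjMatrix, blockMatrix, fromBlocks_map, blockDiagonal'_map]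

theorem blockMatrix_injective
    {A A' : ∀ i, Matrix (Fin (k i) ⊕ Fin (k i)) (Fin (k i) ⊕ Fin (k i)) ℂ}
    {B B' : Matrix (Fin m₁) (Fin m₁) ℂ} {C C' : Matrix (Fin m₂) (Fin m₂) ℂ}
    (h : blockMatrix A B C = blockMatrix A' B' C') : A = A' ∧ B = B' ∧ C = C' := by
  rw [blockMatrix, blockMatrix, fromBlocks_inj, fromBlocks_inj] at h
  exact ⟨blockDiagonal'_injective h.1, h.2.2.2.1, h.2.2.2.2.2.2⟩

/-- A unitary matrix is symplectic if and only if it commutes with the quaternionic structure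
`z ↦ J z̄`. -/
theorem mem_symplecticGroup_iff_of_unitary {r : ℕ} {X : Matrix (Fin r ⊕ Fin r) (Fin r ⊕ Fin r) ℂ}
    (hX : X ∈ unitaryGroup (Fin r ⊕ Fin r) ℂ) :
    X ∈ symplecticGroup (Fin r) ℂ ↔ X * J (Fin r) ℂ = J (Fin r) ℂ * conjMatrix X := by
  have h1 : conjMatrix X * Xᵀ = 1 := by
    have := congrArg transpose (mem_unitaryGroup_iff.1 hX)
    rwa [transpose_mul, transpose_one] at this
  have h2 : Xᵀ * conjMatrix X = 1 := mul_eq_one_comm.1 h1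
  rw [SymplecticGroup.mem_iff]
  constructor
  · intro h
    rw [← h, mul_assoc _ Xᵀ, h2, mul_one, h]
  · intro h
    rw [h, mul_assoc, h1, mul_one]

variable (k m₁ m₂) in
/-- The diagonal matrix `(JK + KJ)/2`. -/
noncomputable def eigenMatrix (e : Fin l → ℝ) :
    Matrix (BlockIndex k m₁ m₂) (BlockIndex k m₁ m₂) ℂ :=
  blockMatrix (fun i => (e i : ℂ) • 1) 1 (-1)

variable (k m₁ m₂) in
/-- The matrix of the antilinear part of `K`. -/
noncomputable def antilinearMatrix (s : Fin l → ℝ) :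
    Matrix (BlockIndex k m₁ m₂) (BlockIndex k m₁ m₂) ℂ :=
  blockMatrix (fun i => (s i : ℂ) • J (Fin (k i)) ℂ) 0 0

/-- The eigenvalue of `(JK + KJ)/2` at a given index. -/
def eigenvalueAt (e : Fin l → ℝ) : BlockIndex k m₁ m₂ → ℝ :=
  Sum.elim (fun p => e p.1) (Sum.elim 1 (-1))

theorem eigenMatrix_eq_diagonal (e : Fin l → ℝ) :
    eigenMatrix k m₁ m₂ e = diagonal fun a => (eigenvalueAt e a : ℂ) := by
  ext a b
  rcases a with ⟨i, x⟩ | a | a <;> rcases b with ⟨j, y⟩ | b | b <;>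
    simp [eigenMatrix, blockMatrix, eigenvalueAt, diagonal_apply, Matrix.one_apply,
      blockDiagonal'_apply]
  · by_cases hij : i = j
    · subst hij
      simp
    · simp [hij]
  · split_ifs <;> simp

/-- Commuting with a diagonal matrix kills every entry between indices with different eigenvalues.
-/
theorem exists_eq_blockMatrix {A : Matrix (BlockIndex k m₁ m₂) (BlockIndex k m₁ m₂) ℂ}
    {e : Fin l → ℝ} (he : ∀ i, e i ∈ Set.Ioo (-1 : ℝ) 1)
    (hinj : ∀ i j, 0 < k i → e i = e j → i = j)
    (hA : A * eigenMatrix k m₁ m₂ e = eigenMatrix k m₁ m₂ e * A) :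
    ∃ X B C, A = blockMatrix X B C := by
  have h0 : ∀ a b, eigenvalueAt e a ≠ eigenvalueAt e b → A a b = 0 := by
    intro a b hab
    rw [eigenMatrix_eq_diagonal] at hA
    have := congrFun (congrFun hA a) b
    rw [mul_diagonal, diagonal_mul, mul_comm, ← sub_eq_zero, ← sub_mul, mul_eq_zero,
      sub_eq_zero, Complex.ofReal_inj] at this
    exact this.resolve_left hab.symm
  refine ⟨fun i => of fun x y => A (Sum.inl ⟨i, x⟩) (Sum.inl ⟨i, y⟩),
    of fun x y => A (Sum.inr (Sum.inl x)) (Sum.inr (Sum.inl y)),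
    of fun x y => A (Sum.inr (Sum.inr x)) (Sum.inr (Sum.inr y)), ?_⟩
  ext a b
  rcases a with ⟨i, x⟩ | a | a <;> rcases b with ⟨j, y⟩ | b | b
  · by_cases hij : i = j
    · subst hij
      simp [blockMatrix]
    -- The index `x` witnesses that block `i` is nonempty; empty blocks may repeat an eigenvalue
    -- without harm.
    · have hk : 0 < k i := by
        rcases x with x | x <;> exact lt_of_le_of_lt (Nat.zero_le _) x.2
      rw [h0 (Sum.inl ⟨i, x⟩) (Sum.inl ⟨j, y⟩) fun h => hij (hinj i j hk h)]
      simp [blockMatrix, blockDiagonal'_apply, hij]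
  · rw [h0 (Sum.inl ⟨i, x⟩) (Sum.inr (Sum.inl b)) (he i).2.ne]; rfl
  · rw [h0 (Sum.inl ⟨i, x⟩) (Sum.inr (Sum.inr b)) (he i).1.ne']; rfl
  · rw [h0 (Sum.inr (Sum.inl a)) (Sum.inl ⟨j, y⟩) (he j).2.ne']; rfl
  · rfl
  · rw [h0 _ _ (by simp [eigenvalueAt]; norm_num)]; rfl
  · rw [h0 (Sum.inr (Sum.inr a)) (Sum.inl ⟨j, y⟩) (he j).1.ne]; rfl
  · rw [h0 _ _ (by simp [eigenvalueAt]; norm_num)]; rfl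
  · rfl

theorem unitary_blockMatrix_iff
    {X : ∀ i, Matrix (Fin (k i) ⊕ Fin (k i)) (Fin (k i) ⊕ Fin (k i)) ℂ}
    {B : Matrix (Fin m₁) (Fin m₁) ℂ} {C : Matrix (Fin m₂) (Fin m₂) ℂ}
    (h : blockMatrix X B C * star (blockMatrix X B C) = 1) :
    (∀ i, X i ∈ unitaryGroup _ ℂ) ∧ B ∈ unitaryGroup _ ℂ ∧ C ∈ unitaryGroup _ ℂ := by
  rw [blockMatrix_star, ← blockMatrix_mul, ← blockMatrix_one] at h
  obtain ⟨h1, h2, h3⟩ := blockMatrix_injective h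
  exact ⟨fun i => mem_unitaryGroup_iff.2 (congrFun h1 i), mem_unitaryGroup_iff.2 h2,
    mem_unitaryGroup_iff.2 h3⟩

theorem blockMatrix_commute_eigenMatrix (e : Fin l → ℝ)
    (X : ∀ i, Matrix (Fin (k i) ⊕ Fin (k i)) (Fin (k i) ⊕ Fin (k i)) ℂ)
    (B : Matrix (Fin m₁) (Fin m₁) ℂ) (C : Matrix (Fin m₂) (Fin m₂) ℂ) :
    blockMatrix X B C * eigenMatrix k m₁ m₂ e = eigenMatrix k m₁ m₂ e * blockMatrix X B C := by
  rw [eigenMatrix, ← blockMatrix_mul, ← blockMatrix_mul]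
  simp

theorem blockMatrix_mul_antilinearMatrix_iff {s : Fin l → ℝ} (hs : ∀ i, s i ≠ 0)
    (X : ∀ i, Matrix (Fin (k i) ⊕ Fin (k i)) (Fin (k i) ⊕ Fin (k i)) ℂ)
    (B : Matrix (Fin m₁) (Fin m₁) ℂ) (C : Matrix (Fin m₂) (Fin m₂) ℂ) :
    blockMatrix X B C * antilinearMatrix k m₁ m₂ s =
      antilinearMatrix k m₁ m₂ s * conjMatrix (blockMatrix X B C) ↔
      ∀ i, X i * J (Fin (k i)) ℂ = J (Fin (k i)) ℂ * conjMatrix (X i) := by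
  rw [conjMatrix_blockMatrix, antilinearMatrix, ← blockMatrix_mul, ← blockMatrix_mul]
  constructor
  · intro h i
    have := congrFun (blockMatrix_injective h).1 i
    simp only [Matrix.mul_smul, Matrix.smul_mul] at this
    exact smul_right_injective _ (Complex.ofReal_ne_zero.2 (hs i)) this
  · intro h
    simp only [Matrix.mul_smul, Matrix.smul_mul, h, mul_zero, zero_mul]

variable {n : ℕ}

/-- The eigenvalue equation gives the block form and unitarity passes to each block; for unitary
blocks the antilinear equation is symplecticity, since the scalars `s i` cancel. -/
theorem mem_blockSubgroup_iff (ε : BlockIndex k m₁ m₂ ≃ Fin n) {e s : Fin l → ℝ}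
    (he : ∀ i, e i ∈ Set.Ioo (-1 : ℝ) 1) (hinj : ∀ i j, 0 < k i → e i = e j → i = j)
    (hs : ∀ i, s i ≠ 0) (g : unitaryGroup (Fin n) ℂ) :
    g ∈ blockSubgroup ε ↔
      g.1 * reindex ε ε (eigenMatrix k m₁ m₂ e) = reindex ε ε (eigenMatrix k m₁ m₂ e) * g.1 ∧
      g.1 * reindex ε ε (antilinearMatrix k m₁ m₂ s) =
        reindex ε ε (antilinearMatrix k m₁ m₂ s) * conjMatrix g.1 := by
  obtain ⟨A, hA⟩ := (reindex ε ε).surjective g.1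
  have hmul : ∀ S T : Matrix (BlockIndex k m₁ m₂) (BlockIndex k m₁ m₂) ℂ,
      reindex ε ε S * reindex ε ε T = reindex ε ε (S * T) := fun S T => by
    simp [reindex_apply, submatrix_mul_equiv]
  have hconj : conjMatrix (reindex ε ε A) = reindex ε ε (conjMatrix A) := rfl
  rw [← hA, hconj, hmul, hmul, hmul, hmul, (reindex ε ε).injective.eq_iff,
    (reindex ε ε).injective.eq_iff]
  constructor
  · rintro ⟨⟨X, B, C⟩, hX⟩
    have hAX : A = blockMatrix (fun i => (X i).1.1) B.1 C.1 := by
      refine (reindex ε ε).injective ?_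
      rw [hA, ← hX]
      rfl
    rw [hAX]
    exact ⟨blockMatrix_commute_eigenMatrix e _ _ _,
      (blockMatrix_mul_antilinearMatrix_iff hs _ _ _).2
      fun i => (mem_symplecticGroup_iff_of_unitary (X i).1.2).1 (X i).2⟩
  · rintro ⟨h1, h2⟩
    obtain ⟨X, B, C, rfl⟩ := exists_eq_blockMatrix he hinj h1
    have hu : blockMatrix X B C * star (blockMatrix X B C) = 1 := by
      refine (reindex ε ε).injective ?_
      rw [← hmul]
      have h3 : reindex ε ε (star (blockMatrix X B C)) = star g.1 := by rw [← hA]; rfl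
      rw [h3, hA, mem_unitaryGroup_iff.1 g.2]
      simp [reindex_apply]
    obtain ⟨hX, hB, hC⟩ := unitary_blockMatrix_iff hu
    rw [blockMatrix_mul_antilinearMatrix_iff hs] at h2
    exact ⟨(fun i => ⟨⟨X i, hX i⟩, (mem_symplecticGroup_iff_of_unitary (hX i)).2 (h2 i)⟩,
      ⟨B, hB⟩, ⟨C, hC⟩), Subtype.ext hA⟩

end Blocks

end Twistor

namespace Twistor

open Module Matrix

variable {V : Type*} [NormedAddCommGroup V] [InnerProductSpace ℝ V] {n : ℕ}

/-! ### `K` in coordinates and the matrices commuting with it -/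

section Commutant

/-- Evaluating at `z` and at `i z` separates the linear part from the antilinear one. -/
theorem matrix_eq_of_mulVec_add_mulVec_star {ι : Type*} [Fintype ι] [DecidableEq ι]
    {P P' Q Q' : Matrix ι ι ℂ}
    (h : ∀ z, P *ᵥ z + Q *ᵥ star z = P' *ᵥ z + Q' *ᵥ star z) : P = P' ∧ Q = Q' := by
  have hz : ∀ z, P *ᵥ z = P' *ᵥ z ∧ Q *ᵥ star z = Q' *ᵥ star z := by
    intro z
    have h1 := h z
    have h2 := congrArg (Complex.I • ·) (h (Complex.I • z))
    simp only [mulVec_smul, star_smul, smul_add, smul_smul, Complex.I_mul_I,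
      RCLike.star_def, Complex.conj_I, mulVec_neg, smul_neg, neg_neg, one_smul, neg_smul] at h2
    have h3 : (2 : ℂ) • (Q *ᵥ star z) = (2 : ℂ) • (Q' *ᵥ star z) := by
      rw [two_smul, two_smul]
      linear_combination h1 + h2
    have h4 := smul_right_injective (ι → ℂ) (two_ne_zero (α := ℂ)) h3
    rw [h4] at h1
    exact ⟨add_right_cancel h1, h4⟩
  constructor
  · exact Matrix.ext_of_mulVec_single fun b => (hz _).1
  · refine Matrix.ext_of_mulVec_single fun b => ?_
    have := (hz (Pi.single b 1)).2
    rwa [← Pi.single_star, star_one] at this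

theorem star_mulVec_eq {ι : Type*} [Fintype ι] (A : Matrix ι ι ℂ) (z : ι → ℂ) :
    star (A *ᵥ z) = conjMatrix A *ᵥ star z := by
  ext a
  simp [mulVec, dotProduct, conjMatrix]

variable {J K : V →L[ℝ] V} {u : Fin n → V}

/-- Both sides are real linear in `z`, so it suffices to test basis vectors and `i` times them. The
latter follow from the former through `K J u_b = 2 d_b u_b - J K u_b`. -/
theorem apply_frameMap_eq (hJ : J ∈ twistorSpace V)
    {D S : Matrix (Fin n) (Fin n) ℂ} {d : Fin n → ℝ}
    (hd : ∀ b, u b ∈ eigenspace J K (d b)) (hD : D = diagonal fun b => (d b : ℂ))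
    (hK : ∀ b, K (u b) = -(d b • J (u b)) + frameMap J u (S.col b)) (z : Fin n → ℂ) :
    K (frameMap J u z) = frameMap J u (-Complex.I • (D *ᵥ z) + S *ᵥ star z) := by
  have hDb : ∀ b, frameMap J u (D *ᵥ Pi.single b 1) = d b • u b := fun b => by
    rw [hD, ← frameMap_single J u b, ← map_smul]
    congr 1
    ext a
    simp [Pi.single_apply, eq_comm]
  have h1 : ∀ b, K (frameMap J u (Pi.single b 1)) =
      frameMap J u (-Complex.I • (D *ᵥ Pi.single b 1) + S *ᵥ star (Pi.single b 1)) := fun b => by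
    rw [frameMap_single, hK, map_add, neg_smul, map_neg, ← apply_frameMap hJ, hDb, map_smul,
      ← Pi.single_star, star_one, mulVec_single_one]
  have h2 : ∀ b, K (frameMap J u (Complex.I • Pi.single b 1)) =
      frameMap J u (-Complex.I • (D *ᵥ (Complex.I • Pi.single b 1)) +
        S *ᵥ star (Complex.I • Pi.single b 1)) := fun b => by
    have h3 := mem_eigenspace_iff.1 (hd b)
    rw [← apply_frameMap hJ, frameMap_single, eq_sub_of_add_eq' h3, ← frameMap_single J u b, h1,
      frameMap_single, apply_frameMap hJ, mul_smul, ← hDb, ← map_smul, ← map_sub]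
    congr 1
    simp only [mulVec_smul, star_smul, smul_add, smul_smul, Complex.I_mul_I,
      RCLike.star_def, Complex.conj_I, mulVec_neg, smul_neg, neg_mul, neg_neg, one_smul, neg_smul]
    ext a
    simp
    ring
  let f : (Fin n → ℂ) →ₗ[ℝ] V := K.toLinearMap ∘ₗ frameMap J u
  let g : (Fin n → ℂ) →ₗ[ℝ] V := frameMap J u ∘ₗ
    { toFun := fun z => -Complex.I • (D *ᵥ z) + S *ᵥ star z
      map_add' := fun z w => by
        rw [mulVec_add, star_add, mulVec_add, smul_add]
        abel
      map_smul' := fun c z => by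
        simp only [mulVec_smul, star_smul, smul_add, RingHom.id_apply, star_trivial]
        rw [smul_comm] }
  have hfg : f = g := by
    refine LinearMap.pi_ext fun b x => ?_
    have hx : Pi.single b x = x.re • (Pi.single b 1 : Fin n → ℂ) +
        x.im • (Complex.I • Pi.single b 1) := by
      ext a
      by_cases hab : a = b
      · subst hab
        simp [Complex.re_add_im x]
      · simp [Pi.single_eq_of_ne hab]
    have h1' : f (Pi.single b 1) = g (Pi.single b 1) := h1 b
    have h2' : f (Complex.I • Pi.single b 1) = g (Complex.I • Pi.single b 1) := h2 b
    rw [hx, map_add, map_add, f.map_smul, f.map_smul, g.map_smul x.re, g.map_smul x.im, h1', h2']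
  exact DFunLike.congr_fun hfg z

variable [FiniteDimensional ℝ V] (hJ : J ∈ twistorSpace V) (hu : IsUnitaryFrame J u)
  (hn : finrank ℝ V = 2 * n)

theorem commute_matrixHom_iff {D S : Matrix (Fin n) (Fin n) ℂ}
    (hK : ∀ z, K (frameMap J u z) = frameMap J u (-Complex.I • (D *ᵥ z) + S *ᵥ star z))
    (A : Matrix (Fin n) (Fin n) ℂ) :
    Commute (matrixHom hJ hu hn A) K ↔ A * D = D * A ∧ A * S = S * conjMatrix A := by
  have key : Commute (matrixHom hJ hu hn A) K ↔
      ∀ z, (-Complex.I • (A * D)) *ᵥ z + (A * S) *ᵥ star z =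
        (-Complex.I • (D * A)) *ᵥ z + (S * conjMatrix A) *ᵥ star z := by
    have h1 : Commute (matrixHom hJ hu hn A) K ↔ ∀ z, matrixHom hJ hu hn A (K (frameMap J u z)) =
        K (matrixHom hJ hu hn A (frameMap J u z)) := by
      constructor
      · exact fun h z => DFunLike.congr_fun h _
      · intro h
        refine ContinuousLinearMap.ext fun x => ?_
        obtain ⟨z, rfl⟩ := frameMap_surjective hJ hu hn x
        exact h z
    rw [h1]
    refine forall_congr' fun z => ?_
    rw [hK, matrixHom_frameMap, matrixHom_frameMap, hK, (frameMap_injective hJ hu).eq_iff,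
      star_mulVec_eq, mulVec_add, mulVec_smul, mulVec_mulVec, mulVec_mulVec, mulVec_mulVec,
      mulVec_mulVec, smul_mulVec, smul_mulVec]
  rw [key]
  constructor
  · intro h
    obtain ⟨h1, h2⟩ := matrix_eq_of_mulVec_add_mulVec_star h
    exact ⟨smul_right_injective _ (neg_ne_zero.2 Complex.I_ne_zero) h1, h2⟩
  · rintro ⟨h1, h2⟩ z
    rw [h1, h2]

end Commutant

/-! ### A unitary frame adapted to `K` -/

section AdaptedFrame

variable {l : ℕ} {k : Fin l → ℕ} {m₁ m₂ : ℕ}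

theorem frameMap_antilinearMatrix_col (J : V →L[ℝ] V) (ε : BlockIndex k m₁ m₂ ≃ Fin n)
    (s : Fin l → ℝ) (v : BlockIndex k m₁ m₂ → V) (b : BlockIndex k m₁ m₂) :
    frameMap J (v ∘ ε.symm) ((reindex ε ε (antilinearMatrix k m₁ m₂ s)).col (ε b)) =
      ∑ a, (antilinearMatrix k m₁ m₂ s a b).re • v a +
        ∑ a, (antilinearMatrix k m₁ m₂ s a b).im • J (v a) := by
  rw [frameMap_apply, Finset.sum_add_distrib, ← ε.sum_comp, ← ε.sum_comp]
  simp

/-- The value of the antilinear part of `K` on an adapted frame. -/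
def antilinearAt (s : Fin l → ℝ) (v : BlockIndex k m₁ m₂ → V) : BlockIndex k m₁ m₂ → V :=
  Sum.elim (fun p => Sum.elim (fun x => s p.1 • v (Sum.inl ⟨p.1, Sum.inr x⟩))
    (fun x => -(s p.1 • v (Sum.inl ⟨p.1, Sum.inl x⟩))) p.2) 0

theorem frameMap_antilinearMatrix_col_eq (J : V →L[ℝ] V) (ε : BlockIndex k m₁ m₂ ≃ Fin n)
    (s : Fin l → ℝ) (v : BlockIndex k m₁ m₂ → V) (b : BlockIndex k m₁ m₂) :
    frameMap J (v ∘ ε.symm) ((reindex ε ε (antilinearMatrix k m₁ m₂ s)).col (ε b)) =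
      antilinearAt s v b := by
  rw [frameMap_antilinearMatrix_col]
  rcases b with ⟨i, x | x⟩ | b | b
  all_goals simp only [antilinearMatrix, blockMatrix, antilinearAt, Fintype.sum_sum_type,
    Fintype.sum_sigma]
  · rw [Finset.sum_eq_single i, Finset.sum_eq_single i]
    · simp [Matrix.J, Matrix.one_apply, apply_ite]
    all_goals simp +contextual [blockDiagonal'_apply]
  · rw [Finset.sum_eq_single i, Finset.sum_eq_single i]
    · simp [Matrix.J, Matrix.one_apply, apply_ite]
    all_goals simp +contextual [blockDiagonal'_apply]
  · simp
  · simp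

variable [FiniteDimensional ℝ V] {J K : V →L[ℝ] V}

/-- Frames of the separate eigenspaces are put together; unitarity across them holds because the
eigenspaces are orthogonal and `J`-stable. -/
theorem exists_adaptedFrame (hJ : J ∈ twistorSpace V) (hK : K ∈ twistorSpace V)
    {e : Fin l → ℝ} (he : ∀ i, e i ∈ Set.Ioo (-1 : ℝ) 1)
    (hinj : ∀ i j, 0 < k i → e i = e j → i = j)
    (hk : ∀ i, finrank ℝ (eigenspace J K (e i)) = 4 * k i)
    (hm₁ : finrank ℝ (eigenspace J K 1) = 2 * m₁)
    (hm₂ : finrank ℝ (eigenspace J K (-1)) = 2 * m₂) :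
    ∃ v : BlockIndex k m₁ m₂ → V, IsUnitaryFrame J v ∧
      (∀ a, v a ∈ eigenspace J K (eigenvalueAt e a)) ∧
      ∀ a, K (v a) = -(eigenvalueAt e a • J (v a)) +
        antilinearAt (fun i => √(1 - e i ^ 2)) v a := by
  have hJs := inner_apply_of_mem_twistorSpace hJ
  have hKs := inner_apply_of_mem_twistorSpace hK
  have hs : ∀ i, 0 < 1 - e i ^ 2 := fun i => by nlinarith [(he i).1, (he i).2]
  have hq : ∀ i, ∃ q : Fin (k i) ⊕ Fin (k i) → V, (∀ a, q a ∈ eigenspace J K (e i)) ∧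
      IsUnitaryFrame J q ∧
      (∀ x, K (q (Sum.inl x)) = -(e i • J (q (Sum.inl x))) + √(1 - e i ^ 2) • q (Sum.inr x)) ∧
      ∀ x, K (q (Sum.inr x)) = -(e i • J (q (Sum.inr x))) + -(√(1 - e i ^ 2) • q (Sum.inl x)) := by
    intro i
    set r := √(1 - e i ^ 2)
    have hr : 0 < r := Real.sqrt_pos.2 (hs i)
    have hr2 : r * r = 1 - e i ^ 2 := Real.mul_self_sqrt (hs i).le
    -- The normalized antilinear part of `K`. On this eigenspace `(K + e J)² = -1 - e² + 2e² = -r²`,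
    -- so `I` is a second complex structure, anticommuting with `J`.
    let I : V →L[ℝ] V := r⁻¹ • (K + e i • J)
    have hI : ∀ x, I x = r⁻¹ • (K x + e i • J x) := fun x => rfl
    have hKI : ∀ x, K x = -(e i • J x) + r • I x := fun x => by
      rw [hI, smul_smul, mul_inv_cancel₀ hr.ne']
      module
    obtain ⟨q, hqW, hqu, hq1, hq2⟩ := exists_quaternionicFrame (J := J) (I := I)
      (W := eigenspace J K (e i)) hJs
      (fun x y => by
        simp only [hI, real_inner_smul_left, real_inner_smul_right, inner_add_left, inner_add_right,
          hJs x, hKs x]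
        ring)
      (fun x hx => apply_left_mem_eigenspace hJ hx)
      (fun x hx => Submodule.smul_mem _ _ (add_mem (apply_right_mem_eigenspace hK hx)
        (Submodule.smul_mem _ _ (apply_left_mem_eigenspace hJ hx))))
      (fun x _ => apply_apply_of_mem_twistorSpace hJ x)
      (fun x hx => by
        have h1 : K (J x) = (2 * e i) • x - J (K x) :=
          eq_sub_of_add_eq' (mem_eigenspace_iff.1 hx)
        simp only [hI, map_smul, map_add, apply_apply_of_mem_twistorSpace hJ,
          apply_apply_of_mem_twistorSpace hK, h1]
        have h2 : r⁻¹ * r⁻¹ * (1 - e i ^ 2) = 1 := by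
          rw [← hr2]
          field_simp
        calc _ = -(r⁻¹ * r⁻¹ * (1 - e i ^ 2)) • x := by module
          _ = -x := by rw [h2, neg_one_smul])
      (fun x hx => by
        have h1 : K (J x) = (2 * e i) • x - J (K x) :=
          eq_sub_of_add_eq' (mem_eigenspace_iff.1 hx)
        simp only [hI, map_smul, map_add, apply_apply_of_mem_twistorSpace hJ, h1]
        module)
      (k i) (hk i)
    exact ⟨q, hqW, hqu, fun x => by rw [hKI, hq1], fun x => by rw [hKI, hq2, smul_neg]⟩
  choose q hqW hqu hq1 hq2 using hq
  obtain ⟨p₁, hp₁W, hp₁⟩ := exists_unitaryFrame (W := eigenspace J K 1) hJs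
    (fun x hx => apply_left_mem_eigenspace hJ hx)
    (fun x _ => apply_apply_of_mem_twistorSpace hJ x) m₁ hm₁
  obtain ⟨p₂, hp₂W, hp₂⟩ := exists_unitaryFrame (W := eigenspace J K (-1)) hJs
    (fun x hx => apply_left_mem_eigenspace hJ hx)
    (fun x _ => apply_apply_of_mem_twistorSpace hJ x) m₂ hm₂
  let v : BlockIndex k m₁ m₂ → V := Sum.elim (fun p => q p.1 p.2) (Sum.elim p₁ p₂)
  have hv : ∀ a, v a ∈ eigenspace J K (eigenvalueAt e a) := by
    rintro (⟨i, x⟩ | a | a)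
    exacts [hqW i x, hp₁W a, hp₂W a]
  have hblock : ∀ i j (x : Fin (k i) ⊕ Fin (k i)), e i = e j → i = j := fun i j x h =>
    hinj i j (by rcases x with x | x <;> exact lt_of_le_of_lt (Nat.zero_le _) x.2) h
  refine ⟨v, ⟨orthonormal_iff_ite.2 fun a b => ?_, fun a b => ?_⟩, hv, ?_⟩
  · by_cases hab : eigenvalueAt e a = eigenvalueAt e b
    · rcases a with ⟨i, x⟩ | a | a <;> rcases b with ⟨j, y⟩ | b | b
      · obtain rfl := hblock i j x hab
        exact (orthonormal_iff_ite.1 (hqu i).1 x y).trans (by simp)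
      · exact absurd hab (he i).2.ne
      · exact absurd hab (he i).1.ne'
      · exact absurd hab (he j).2.ne'
      · exact (orthonormal_iff_ite.1 hp₁.1 a b).trans (by simp)
      · norm_num [eigenvalueAt] at hab
      · exact absurd hab (he j).1.ne
      · norm_num [eigenvalueAt] at hab
      · exact (orthonormal_iff_ite.1 hp₂.1 a b).trans (by simp)
    · rw [inner_eq_zero_of_mem_eigenspace hJ hK hab (hv a) (hv b), if_neg]
      rintro rfl
      exact hab rfl
  · by_cases hab : eigenvalueAt e a = eigenvalueAt e b
    · rcases a with ⟨i, x⟩ | a | a <;> rcases b with ⟨j, y⟩ | b | b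
      · obtain rfl := hblock i j x hab
        exact (hqu i).2 x y
      · exact absurd hab (he i).2.ne
      · exact absurd hab (he i).1.ne'
      · exact absurd hab (he j).2.ne'
      · exact hp₁.2 a b
      · norm_num [eigenvalueAt] at hab
      · exact absurd hab (he j).1.ne
      · norm_num [eigenvalueAt] at hab
      · exact hp₂.2 a b
    · exact inner_eq_zero_of_mem_eigenspace hJ hK hab (hv a) (apply_left_mem_eigenspace hJ (hv b))
  · rintro (⟨i, x | x⟩ | a | a)
    · exact hq1 i x
    · exact hq2 i x
    · exact (apply_eq_neg_smul_of_mem_eigenspace hJ hK (by norm_num) (hp₁W a)).trans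
        (add_zero _).symm
    · exact (apply_eq_neg_smul_of_mem_eigenspace hJ hK (by norm_num) (hp₂W a)).trans
        (add_zero _).symm

end AdaptedFrame

end Twistor

namespace Twistor

open Module

/-! ### Dimension count and distinctness of the eigenvalues -/

section Dimensions

variable {V : Type*} [NormedAddCommGroup V] [InnerProductSpace ℝ V]
  {J K : V →L[ℝ] V} {l : ℕ} {e : Fin l → ℝ} {k : Fin l → ℕ} {m₁ m₂ : ℕ}

theorem finrank_eq_two_mul_card_blockIndex [FiniteDimensional ℝ V]
    (hV : DirectSum.IsInternal (eigenspaces J K e))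
    (hk : ∀ i, finrank ℝ (eigenspace J K (e i)) = 4 * k i)
    (hm₁ : finrank ℝ (eigenspace J K 1) = 2 * m₁)
    (hm₂ : finrank ℝ (eigenspace J K (-1)) = 2 * m₂) :
    finrank ℝ V = 2 * Fintype.card (BlockIndex k m₁ m₂) := by
  have h := (LinearEquiv.ofBijective (DirectSum.coeLinearMap (eigenspaces J K e)) hV).finrank_eq
  have hL : ∀ i, finrank ℝ (eigenspaces J K e (Sum.inl i)) = 4 * k i := hk
  have h0 : finrank ℝ (eigenspaces J K e (Sum.inr 0)) = 2 * m₁ := hm₁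
  have h1 : finrank ℝ (eigenspaces J K e (Sum.inr 1)) = 2 * m₂ := hm₂
  rw [← h, finrank_directSum, Fintype.sum_sum_type, Fin.sum_univ_two]
  simp only [hL, h0, h1, Fintype.card_sum, Fintype.card_sigma, Fintype.card_fin, mul_add,
    Finset.mul_sum]
  congr 1
  exact Finset.sum_congr rfl fun i _ => by ring

/-- Two independent summands that coincide are zero, which a positive `k i` forbids. -/
theorem eq_of_isInternal_eigenspaces (hV : DirectSum.IsInternal (eigenspaces J K e))
    (hk : ∀ i, finrank ℝ (eigenspace J K (e i)) = 4 * k i) (i j : Fin l) (hi : 0 < k i)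
    (hij : e i = e j) : i = j := by
  by_contra hne
  have hd := hV.submodule_iSupIndep.pairwiseDisjoint (Sum.inl_injective.ne hne)
  have hd' : Disjoint (eigenspace J K (e i)) (eigenspace J K (e j)) := hd
  rw [← hij, disjoint_self] at hd'
  have := hk i
  rw [hd', finrank_bot] at this
  omega

end Dimensions

end Twistor

theorem theorem7p2 {V : Type*} [NormedAddCommGroup V] [InnerProductSpace ℝ V]
    [FiniteDimensional ℝ V] (n : ℕ) (hn : Module.finrank ℝ V = 2 * n)
    (J K : V →L[ℝ] V) (hJ : J ∈ Twistor.twistorSpace V) (hK : K ∈ Twistor.twistorSpace V)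
    (l : ℕ) (e : Fin l → ℝ) (he : ∀ i, e i ∈ Set.Ioo (-1 : ℝ) 1)
    (hV : DirectSum.IsInternal (Twistor.eigenspaces J K e))
    (k : Fin l → ℕ) (hk : ∀ i, Module.finrank ℝ (Twistor.eigenspace J K (e i)) = 4 * k i)
    (m₁ m₂ : ℕ) (hm₁ : Module.finrank ℝ (Twistor.eigenspace J K 1) = 2 * m₁)
    (hm₂ : Module.finrank ℝ (Twistor.eigenspace J K (-1)) = 2 * m₂) :
    ∃ ε : Twistor.BlockIndex k m₁ m₂ ≃ Fin n,
    -- the smooth structures of `U(n)`, of the homogeneous space and of the orbit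
    ∃ (c d : ℕ)
      (_ : ChartedSpace (EuclideanSpace ℝ (Fin c)) (Matrix.unitaryGroup (Fin n) ℂ))
      (_ : ChartedSpace (EuclideanSpace ℝ (Fin d))
        (Matrix.unitaryGroup (Fin n) ℂ ⧸ Twistor.blockSubgroup ε))
      (_ : ChartedSpace (EuclideanSpace ℝ (Fin d)) (Twistor.orbit J K)),
      Twistor.IsEmbeddedSubmanifold c
        (Subtype.val : Matrix.unitaryGroup (Fin n) ℂ → Matrix (Fin n) (Fin n) ℂ) ∧
      Twistor.IsQuotientManifold c (Twistor.blockSubgroup ε) d ∧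
      Twistor.IsEmbeddedSubmanifold d (Subtype.val : Twistor.orbit J K → V →L[ℝ] V) ∧
      -- an isomorphism of topological groups `U(n) ≅ U(J)` and an equivariant diffeomorphism
      ∃ (θ : Matrix.unitaryGroup (Fin n) ℂ ≃ₜ* Twistor.unitaryOf J)
        (Φ : (Matrix.unitaryGroup (Fin n) ℂ ⧸ Twistor.blockSubgroup ε)
          ≃ₘ⟮𝓡 d, 𝓡 d⟯ Twistor.orbit J K),
        ∀ g : Matrix.unitaryGroup (Fin n) ℂ,
          (Φ (QuotientGroup.mk g) : V →L[ℝ] V) =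
            ((θ g : (V →L[ℝ] V)ˣ) : V →L[ℝ] V) * K * ((θ g : (V →L[ℝ] V)ˣ)⁻¹ : (V →L[ℝ] V)ˣ) := by
  have hcard := Twistor.finrank_eq_two_mul_card_blockIndex hV hk hm₁ hm₂
  have hinj := Twistor.eq_of_isInternal_eigenspaces hV hk
  let ε : Twistor.BlockIndex k m₁ m₂ ≃ Fin n := Fintype.equivFinOfCardEq (by omega)
  obtain ⟨v, hv, hve, hvK⟩ := Twistor.exists_adaptedFrame hJ hK he hinj hk hm₁ hm₂
  let u : Fin n → V := v ∘ ε.symm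
  have hu : Twistor.IsUnitaryFrame J u :=
    ⟨hv.1.comp _ ε.symm.injective, fun a b => hv.2 _ _⟩
  -- Here `e i ≠ ±1` matters: a vanishing antilinear part would impose no symplectic condition.
  have hs : ∀ i, √(1 - e i ^ 2) ≠ 0 := fun i =>
    (Real.sqrt_pos.2 (by nlinarith [(he i).1, (he i).2])).ne'
  have hKu := Twistor.apply_frameMap_eq (u := u) (K := K) hJ
    (d := fun b => Twistor.eigenvalueAt e (ε.symm b))
    (D := Matrix.reindex ε ε (Twistor.eigenMatrix k m₁ m₂ e))
    (S := Matrix.reindex ε ε (Twistor.antilinearMatrix k m₁ m₂ fun i => √(1 - e i ^ 2)))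
    (fun b => hve _)
    (by
      rw [Twistor.eigenMatrix_eq_diagonal, Matrix.reindex_apply,
        Matrix.submatrix_diagonal_equiv]
      rfl)
    (fun b => by
      have h := Twistor.frameMap_antilinearMatrix_col_eq J ε (fun i => √(1 - e i ^ 2)) v (ε.symm b)
      rw [ε.apply_symm_apply] at h
      rw [h]
      exact hvK _)
  have hH : ∀ g : Matrix.unitaryGroup (Fin n) ℂ, g ∈ Twistor.blockSubgroup ε ↔
      Commute (Twistor.matrixHom hJ hu hn g.1) K := fun g => by
    rw [Twistor.mem_blockSubgroup_iff ε he hinj hs g,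
      Twistor.commute_matrixHom_iff hJ hu hn hKu]
  obtain ⟨c, d, cU, cQ, cO, h1, h2, h3, Φ, hΦ⟩ :=
    Twistor.exists_smooth_structures hH (Twistor.orbit_eq_range_conjBy hJ hu hn K)
  exact ⟨ε, c, d, cU, cQ, cO, h1, h2, h3, Twistor.unitaryEquiv hJ hu hn, Φ, hΦ⟩
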